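/- Let $\mathcal X,\mathcal Y$ be finite alphabets and let $P_{XY},Q_{XY}$ be pmfs on $\mathcal X\times\mathcal Y$. A transmitter observes $X^n$ and sends a message $M\in\{0,\dots,\lfloor 2^{nR}\rfloor\}$, produced by a (possibly stochastic) encoder from $X^n$; a receiver observes $Y^n$ and $M$ and produces a guess $\hat{\mathcal H}=g^{(n)}(Y^n,M)\in\{0,1\}$. Under $\mathcal H=0$ the pairs $(X_i,Y_i)$ are i.i.d. $P_{XY}$, under $\mathcal H=1$ they are i.i.d. $Q_{XY}$. An exponent $\theta\ge 0$ is $\epsilon$-achievable at rate $R$ if there is a sequence of encoders and guessing functions, $n=1,2,\dots$, with $\alpha_n=\Pr[\hat{\mathcal H}=1\mid\mathcal H=0]\le\epsilon$ for all $n$ and $-\varlimsup_{n\to\infty}\frac1n\log\beta_n\ge\theta$, where $\beta_n=\Pr[\hat{\mathcal H}=0\mid\mathcal H=1]$. Let $\theta^*(R)\in[0,\infty]$ be the supremum of all $\theta\ge0$ that are $\epsilon$-achievable at rate $R$ for every $\epsilon>0$. All logarithms, entropies, mutual informations $I$ and Kullback--Leibler divergences $D$ are to base $2$, and $D$ may be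 $+\infty$. Let $\mathcal S$ be a finite alphabet and $P_{S|X}$ a conditional pmf, and put $P_{SXY}=P_{S|X}P_{XY}$; $I(S;X|Y)$, $I(S;X)$ and $H(S|Y)$ are computed under $P_{SXY}$. The minima below are over pmfs $\tilde P_{SXY}$ on $\mathcal S\times\mathcal X\times\mathcal Y$. (i) If $R\ge I(S;X|Y)$, then $$\theta^*(R)\ \ge\ \min\Bigg\{\min_{\substack{\tilde P_{SXY}:\ \tilde P_{SX}=P_{SX}\\ \tilde P_{SY}=P_{SY}}} D(\tilde P_{SXY}\|P_{S|X}Q_{XY}),\ \ \min_{\substack{\tilde P_{SXY}:\ \tilde P_{SX}=P_{SX},\ \tilde P_Y=P_Y\\ H(S|Y)\le H_{\tilde P_{SY}}(S|Y)}} D(\tilde P_{SXY}\|P_{S|X}Q_{XY})+R-I(S;X|Y)\Bigg\}.$$ (ii) If $R\ge I(S;X)$, then $$\theta^*(R)\ \ge\ \min_{\substack{\tilde P_{SXY}:\ \tilde P_{SX}=P_{SX}\\ \tilde P_{SY}=P_{SY}}} D(\tilde P_{SXY}\|P_{S|X}Q_{XY}).$$ -/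

import Mathlib

open Filter

noncomputable section

namespace BinTest

/-! Probability mass functions on a finite alphabet `A` are the elements of `stdSimplex ℝ A`.
All logarithms are to base 2. -/

section Information

variable {A B S X Y : Type*} [Fintype A] [Fintype B] [Fintype S] [Fintype X] [Fintype Y]

/-- Marginal of the first coordinate. -/
def margFst (p : A × B → ℝ) : A → ℝ := fun a => ∑ b, p (a, b)

/-- Marginal of the second coordinate. -/
def margSnd (p : A × B → ℝ) : B → ℝ := fun b => ∑ a, p (a, b)

/-- The `(S, X)`-marginal of a pmf of `(S, X, Y)`. -/
def margSX (p : S × X × Y → ℝ) : S × X → ℝ := fun a => ∑ y, p (a.1, a.2, y)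

/-- The `(S, Y)`-marginal of a pmf of `(S, X, Y)`. -/
def margSY (p : S × X × Y → ℝ) : S × Y → ℝ := fun a => ∑ x, p (a.1, x, a.2)

/-- The `(X, Y)`-marginal of a pmf of `(S, X, Y)`. -/
def margXY (p : S × X × Y → ℝ) : X × Y → ℝ := margSnd p

/-- The `Y`-marginal of a pmf of `(S, X, Y)`. -/
def margY (p : S × X × Y → ℝ) : Y → ℝ := margSnd (margXY p)

/-- Shannon entropy `H(A)` in bits. -/
def entropy (p : A → ℝ) : ℝ := -∑ a, p a * Real.logb 2 (p a)

/-- Conditional entropy `H(A|B) = H(A,B) - H(B)` of a pmf of `(A, B)`. -/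
def condEntropy (p : A × B → ℝ) : ℝ := entropy p - entropy (margSnd p)

/-- Mutual information `I(A;B) = H(A) - H(A|B)` of a pmf of `(A, B)`. -/
def mutualInfo (p : A × B → ℝ) : ℝ := entropy (margFst p) - condEntropy p

/-- Conditional mutual information `I(S;X|Y) = H(S|Y) - H(S|X,Y)` of a pmf of `(S, X, Y)`. -/
def condMutualInfo (p : S × X × Y → ℝ) : ℝ := condEntropy (margSY p) - condEntropy p

open Classical in
/-- Kullback–Leibler divergence `D(p‖q)` in bits; it is `⊤` unless `p` is absolutely continuous
with respect to `q`. -/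
def klDivergence (p q : A → ℝ) : EReal :=
  if ∀ a, q a = 0 → p a = 0 then ((∑ a, p a * Real.logb 2 (p a / q a) : ℝ) : EReal) else ⊤

/-- The pmf `P_{S|X} P_{XY}` of `(S, X, Y)`. -/
def joint (W : X → S → ℝ) (P : X × Y → ℝ) : S × X × Y → ℝ := fun a => W a.2.1 a.1 * P a.2

/-- The pmfs of `(S, X, Y)` whose `(S, X)`- and `(S, Y)`-marginals agree with those of
`PSXY`. -/
def matchingSet (PSXY : S × X × Y → ℝ) : Set (S × X × Y → ℝ) :=
  {p | p ∈ stdSimplex ℝ (S × X × Y) ∧ margSX p = margSX PSXY ∧ margSY p = margSY PSXY}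

/-- The pmfs of `(S, X, Y)` whose `(S, X)`- and `Y`-marginals agree with those of `PSXY` and
whose conditional entropy `H(S|Y)` is at least that of `PSXY`. -/
def binningSet (PSXY : S × X × Y → ℝ) : Set (S × X × Y → ℝ) :=
  {p | p ∈ stdSimplex ℝ (S × X × Y) ∧ margSX p = margSX PSXY ∧ margY p = margY PSXY ∧
    condEntropy (margSY PSXY) ≤ condEntropy (margSY p)}

end Information

section HypothesisTest

/-- The messages `{0, …, ⌊2^{nR}⌋}`. -/
abbrev Message (R : ℝ) (n : ℕ) : Type := Fin (⌊(2 : ℝ) ^ ((n : ℝ) * R)⌋₊ + 1)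

/-- A coding and testing scheme of blocklength `n` and rate `R`: a stochastic encoder
(`enc x m` is the probability of sending `m` upon observing `x`) and a guessing function. -/
structure Scheme (X Y : Type*) (R : ℝ) (n : ℕ) where
  enc : (Fin n → X) → Message R n → ℝ
  enc_mem : ∀ x, enc x ∈ stdSimplex ℝ (Message R n)
  guess : (Fin n → Y) → Message R n → Fin 2

variable {X Y : Type*} [Fintype X] [Fintype Y]

/-- The probability that the receiver's guess is `h` when the pairs `(X_i, Y_i)` are i.i.d.
with pmf `P`. -/
def guessProb (P : X × Y → ℝ) {R : ℝ} {n : ℕ} (c : Scheme X Y R n) (h : Fin 2) : ℝ :=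
  ∑ x : Fin n → X, ∑ y : Fin n → Y,
    (∏ i, P (x i, y i)) * ∑ m, c.enc x m * (if c.guess y m = h then 1 else 0)

/-- Base-2 logarithm of a nonnegative real, with `log 0 = -∞`. -/
def elogTwo (t : ℝ) : EReal := if t = 0 then ⊥ else (Real.logb 2 t : EReal)

/-- `θ` is an `ε`-achievable error exponent at rate `R` for testing `P` (null hypothesis `0`)
against `Q` (alternative hypothesis `1`). -/
def IsAchievable (P Q : X × Y → ℝ) (R ε θ : ℝ) : Prop :=
  ∃ c : (n : ℕ) → Scheme X Y R n,
    (∀ n, 1 ≤ n → guessProb P (c n) 1 ≤ ε) ∧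
    (θ : EReal) ≤
      -limsup (fun n : ℕ => ((1 / (n : ℝ) : ℝ) : EReal) * elogTwo (guessProb Q (c n) 0)) atTop

/-- The exponent-rate function `θ*(R)`, with values in `[0, ∞]`. -/
def exponentRate (P Q : X × Y → ℝ) (R : ℝ) : EReal :=
  sSup {t : EReal | ∃ θ : ℝ, t = (θ : EReal) ∧ 0 ≤ θ ∧
    ∀ ε : ℝ, 0 < ε → IsAchievable P Q R ε θ}

end HypothesisTest

end BinTest

end

open BinTest

open Filter

set_option linter.unusedSectionVars false

noncomputable section

/-! The bounds come from random coding with quantization and binning. With `π` the `S`-marginal of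
`joint W P`, draw about `2^{n(ρ+ρ')}` codewords i.i.d. from `π^n`, split into `2^{nρ}` bins of size
`2^{nρ'}`, where `ρ ≤ R` and `ρ + ρ'` slightly exceeds `I(S;X)`. The encoder picks a codeword
jointly typical with `x` and sends its bin. The receiver accepts if the bin contains a codeword
typical with `y` and none whose empirical entropy given `y` is below about `H(S|Y)`.

Under `P` the errors are rare: covering provides a codeword, Sanov's bound makes it typical with
`y`, and another codeword of the bin has low entropy with probability about `2^{-n I(S;Y)}`, too
small against `2^{nρ'}`. Under `Q`, acceptance means either that the chosen codeword is typical with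
both `x` and `y`, which gives the first exponent, or that it has high entropy given `y` while
another codeword of the bin is typical with `y`. The latter costs `D + I(S;Y) - ρ'`, and `ρ' ≈
I(S;X) - R` together with the Markov identity `I(S;X|Y) = I(S;X) - I(S;Y)` gives the second
exponent. If `R > I(S;X)`, bins are singletons and the second event disappears.

Typicality means that a joint type lies in an open set around its target, so exponents are infima of
`D` near the constraint sets; compactness of the simplex and lower semicontinuity of `D` return the
exact minima (`eventually_forall_lt_klDivergence`). The coding argument (`exists_code`,
`exists_scheme`, `eventually_exists_scheme`) needs a positive channel and a strict rate inequality.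
Mixing `W` with uniform noise provides both when `R > 0`, since it shrinks both informations by a
factor `1 - t`. When `R = 0` the relevant information vanishes, and a one-bit comparison of the two
marginals is enough. -/

namespace BinTest

/-! ### Method of types -/

section Types

variable {A B : Type*} [Fintype A] [Fintype B]

/-- The probability of the sequence `z` under i.i.d. letters with pmf `r`. -/
def prodProb (r : A → ℝ) {n : ℕ} (z : Fin n → A) : ℝ := ∏ i, r (z i)

open Classical in
/-- The type (empirical distribution) of a sequence. -/
def empirical {n : ℕ} (z : Fin n → A) : A → ℝ := fun a => (∑ i, if z i = a then 1 else 0) / n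

theorem sum_empirical_mul {n : ℕ} (z : Fin n → A) (g : A → ℝ) :
    ∑ a, empirical z a * g a = (∑ i, g (z i)) / n := by
  classical
  simp only [empirical, div_mul_eq_mul_div, ← Finset.sum_div, Finset.sum_mul]
  rw [Finset.sum_comm]
  simp

theorem empirical_nonneg {n : ℕ} (z : Fin n → A) (a : A) : 0 ≤ empirical z a := by
  unfold empirical
  positivity

theorem empirical_pos {n : ℕ} (z : Fin n → A) (i : Fin n) : 0 < empirical z (z i) := by
  classical
  have hn : (0 : ℝ) < n := by exact_mod_cast i.pos
  unfold empirical
  refine div_pos ?_ hn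
  refine Finset.sum_pos' (fun j _ => by positivity) ⟨i, Finset.mem_univ _, by simp⟩

theorem empirical_mem {n : ℕ} (hn : 0 < n) (z : Fin n → A) :
    empirical z ∈ stdSimplex ℝ A := by
  refine ⟨empirical_nonneg z, ?_⟩
  have h := sum_empirical_mul z (fun _ => 1)
  have : (n : ℝ) ≠ 0 := by positivity
  simpa [this] using h

theorem exists_of_empirical_ne_zero {n : ℕ} {z : Fin n → A} {a : A} (h : empirical z a ≠ 0) :
    ∃ i, z i = a := by
  classical
  by_contra! hc
  exact h (by simp [empirical, hc])

theorem margFst_empirical {n : ℕ} (u : Fin n → A) (v : Fin n → B) :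
    margFst (empirical fun i => (u i, v i)) = empirical u := by
  classical
  funext a
  simp only [margFst, empirical, ← Finset.sum_div, Prod.mk.injEq]
  rw [Finset.sum_comm]
  congr 1
  refine Finset.sum_congr rfl fun i _ => ?_
  by_cases h : u i = a <;> simp [h]

theorem margSnd_empirical {n : ℕ} (u : Fin n → A) (v : Fin n → B) :
    margSnd (empirical fun i => (u i, v i)) = empirical v := by
  classical
  funext a
  simp only [margSnd, empirical, ← Finset.sum_div, Prod.mk.injEq]
  rw [Finset.sum_comm]
  congr 1
  refine Finset.sum_congr rfl fun i _ => ?_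
  by_cases h : v i = a <;> simp [h]

theorem prodProb_nonneg {r : A → ℝ} (hr : ∀ a, 0 ≤ r a) {n : ℕ} (z : Fin n → A) :
    0 ≤ prodProb r z := Finset.prod_nonneg fun _ _ => hr _

theorem sum_prodProb (r : A → ℝ) (n : ℕ) : ∑ z : Fin n → A, prodProb r z = (∑ a, r a) ^ n := by
  classical
  have h := (Finset.prod_univ_sum (fun _ : Fin n => (Finset.univ : Finset A))
    (fun _ a => r a)).symm
  simpa [prodProb, Fintype.piFinset_univ] using h

theorem prodProb_eq_rpow {r : A → ℝ} {n : ℕ} {z : Fin n → A} (hr : ∀ i, 0 < r (z i)) :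
    prodProb r z = 2 ^ ((n : ℝ) * ∑ a, empirical z a * Real.logb 2 (r a)) := by
  rcases Nat.eq_zero_or_pos n with rfl | hn
  · simp [prodProb]
  have hn' : (n : ℝ) ≠ 0 := by positivity
  rw [sum_empirical_mul z, mul_div_cancel₀ _ hn', Real.rpow_sum_of_pos two_pos]
  exact Finset.prod_congr rfl fun i _ =>
    (Real.rpow_logb two_pos (by norm_num) (hr i)).symm

/-- A type is determined by its letter counts, each in `{0, …, n}`. -/
theorem card_image_empirical_le (n : ℕ) :
    (Set.range (empirical : (Fin n → A) → A → ℝ)).ncard ≤ (n + 1) ^ Fintype.card A := by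
  classical
  let cnt : (Fin n → A) → A → Fin (n + 1) := fun z a =>
    ⟨(Finset.univ.filter fun i => z i = a).card, Nat.lt_succ_of_le (by
      simpa using Finset.card_le_univ (Finset.univ.filter fun i => z i = a))⟩
  have h : Set.range (empirical : (Fin n → A) → A → ℝ) ⊆
      Set.range fun (k : A → Fin (n + 1)) (a : A) => ((k a : ℕ) : ℝ) / n := by
    rintro _ ⟨z, rfl⟩
    refine ⟨cnt z, ?_⟩
    funext a
    simp [cnt, empirical]
  calc _ ≤ _ := Set.ncard_le_ncard h (Set.finite_range _)
    _ ≤ Nat.card (A → Fin (n + 1)) := by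
      rw [← Set.image_univ, ← Set.ncard_univ]
      exact Set.ncard_image_le
    _ = _ := by simp

/-- Mixing over the types costs at most the number of types. -/
theorem sum_of_type_le {Z : Type*} [Fintype Z] {n : ℕ} (τ : Z → Fin n → A)
    (w : (A → ℝ) → Z → ℝ) (hw : ∀ z z', 0 ≤ w (empirical (τ z)) z')
    (hs : ∀ z, ∑ z', w (empirical (τ z)) z' ≤ 1) :
    ∑ z, w (empirical (τ z)) z ≤ ((n : ℝ) + 1) ^ Fintype.card A := by
  classical
  set I : Finset (A → ℝ) := Finset.univ.image fun z => empirical (τ z) with hI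
  -- Inside one type class the weight is a single sub-probability, so each class contributes at most
  -- 1.
  have h1 : ∑ z, w (empirical (τ z)) z ≤ ∑ p ∈ I, 1 := by
    rw [← Finset.sum_fiberwise_of_maps_to (t := I) (g := fun z => empirical (τ z))
      (fun z _ => Finset.mem_image_of_mem _ (Finset.mem_univ z))]
    refine Finset.sum_le_sum fun p hp => ?_
    obtain ⟨z, -, rfl⟩ := Finset.mem_image.1 hp
    refine le_trans ?_ (hs z)
    calc _ = ∑ z' with empirical (τ z') = empirical (τ z), w (empirical (τ z)) z' :=
          Finset.sum_congr rfl fun z' hz' => by rw [(Finset.mem_filter.1 hz').2]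
      _ ≤ _ := Finset.sum_le_sum_of_subset_of_nonneg (Finset.filter_subset _ _)
          fun z' _ _ => hw z z'
  have h2 : I.card ≤ (n + 1) ^ Fintype.card A := by
    refine le_trans ?_ (card_image_empirical_le (A := A) n)
    rw [← Set.ncard_coe_finset]
    refine Set.ncard_le_ncard ?_ (Set.finite_range _)
    intro p hp
    obtain ⟨z, -, rfl⟩ := Finset.mem_image.1 (Finset.mem_coe.1 hp)
    exact ⟨_, rfl⟩
  calc _ ≤ _ := h1
    _ = (I.card : ℝ) := by simp
    _ ≤ _ := by exact_mod_cast h2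

/-- The probability of a sequence under `r`, compared with that under its own type. -/
theorem prodProb_le_of_le_klDivergence {r : A → ℝ} (hr : ∀ a, 0 ≤ r a) {n : ℕ} {z : Fin n → A}
    {d : ℝ} (hd : (d : EReal) ≤ klDivergence (empirical z) r) :
    prodProb r z ≤ 2 ^ (-((n : ℝ) * d)) * prodProb (empirical z) z := by
  have hp : 0 ≤ prodProb (empirical z) z := prodProb_nonneg (empirical_nonneg z) z
  by_cases h : ∀ i, 0 < r (z i)
  · have hac : ∀ a, r a = 0 → empirical z a = 0 := by
      intro a ha
      by_contra hne
      obtain ⟨i, rfl⟩ := exists_of_empirical_ne_zero hne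
      exact (h i).ne' ha
    rw [klDivergence, if_pos hac, EReal.coe_le_coe_iff] at hd
    rw [prodProb_eq_rpow h, prodProb_eq_rpow (empirical_pos z), ← Real.rpow_add two_pos]
    refine Real.rpow_le_rpow_of_exponent_le (by norm_num) ?_
    have e : ∑ a, empirical z a * Real.logb 2 (empirical z a / r a) =
        ∑ a, empirical z a * Real.logb 2 (empirical z a) -
          ∑ a, empirical z a * Real.logb 2 (r a) := by
      rw [← Finset.sum_sub_distrib]
      refine Finset.sum_congr rfl fun a _ => ?_
      by_cases ha : empirical z a = 0
      · simp [ha]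
      · rw [Real.logb_div ha (fun h0 => ha (hac a h0))]
        ring
    rw [e] at hd
    have := mul_le_mul_of_nonneg_left hd (Nat.cast_nonneg (α := ℝ) n)
    linarith
  · push Not at h
    obtain ⟨i, hi⟩ := h
    have : prodProb r z = 0 := Finset.prod_eq_zero (Finset.mem_univ i) (le_antisymm hi (hr _))
    rw [this]
    positivity

open Classical in
/-- The upper bound in Sanov's theorem. -/
theorem sanov_upper {r : A → ℝ} (hr : ∀ a, 0 ≤ r a) {n : ℕ} (hn : 0 < n) (E : (Fin n → A) → Prop)
    {d : ℝ} (hd : ∀ z, E z → (d : EReal) ≤ klDivergence (empirical z) r) :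
    ∑ z, (if E z then prodProb r z else 0) ≤
      ((n : ℝ) + 1) ^ Fintype.card A * 2 ^ (-((n : ℝ) * d)) := by
  have h1 : ∑ z : Fin n → A, prodProb (empirical z) z ≤ ((n : ℝ) + 1) ^ Fintype.card A := by
    refine sum_of_type_le (Z := Fin n → A) (fun z => z) (fun p z => prodProb p z)
      (fun z z' => prodProb_nonneg (empirical_nonneg z) z') fun z => ?_
    rw [sum_prodProb, (empirical_mem hn z).2, one_pow]
  calc _ ≤ ∑ z : Fin n → A, 2 ^ (-((n : ℝ) * d)) * prodProb (empirical z) z := by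
        refine Finset.sum_le_sum fun z _ => ?_
        split_ifs with h
        · exact prodProb_le_of_le_klDivergence hr (hd z h)
        · exact mul_nonneg (by positivity) (prodProb_nonneg (empirical_nonneg z) z)
    _ ≤ _ := by
        rw [← Finset.mul_sum, mul_comm]
        gcongr

open Classical in
/-- There are few sequences with small conditional empirical entropy given `y`. -/
theorem card_condEntropy_le {n : ℕ} (y : Fin n → B) (h : ℝ) :
    ∑ s : Fin n → A, (if condEntropy (empirical fun i => (s i, y i)) ≤ h then (1 : ℝ) else 0) ≤
      ((n : ℝ) + 1) ^ Fintype.card (A × B) * 2 ^ ((n : ℝ) * h) := by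
  -- `w p` is the product of the conditional laws of `p` given `y`. Under its own joint type a
  -- sequence has weight `2^{-nH(A|B)}`, so bounding the total weight counts the sequences of small
  -- entropy.
  let w : (A × B → ℝ) → (Fin n → A) → ℝ := fun p s => ∏ i, p (s i, y i) / margSnd p (y i)
  have hmn : ∀ (s : Fin n → A) b, 0 ≤ margSnd (empirical fun i => (s i, y i)) b := fun s b =>
    Finset.sum_nonneg fun a _ => empirical_nonneg _ _
  have h1 : ∑ s : Fin n → A, w (empirical fun i => (s i, y i)) s ≤
      ((n : ℝ) + 1) ^ Fintype.card (A × B) := by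
    refine sum_of_type_le (Z := Fin n → A) (fun s i => (s i, y i)) w (fun s s' => ?_) fun s => ?_
    · exact Finset.prod_nonneg fun i _ => div_nonneg (empirical_nonneg _ _) (hmn _ _)
    · set p := empirical fun i => (s i, y i)
      have e := (Finset.prod_univ_sum (fun _ : Fin n => (Finset.univ : Finset A))
        (fun i a => p (a, y i) / margSnd p (y i))).symm
      simp only [Fintype.piFinset_univ] at e
      simp only [w]
      rw [e]
      refine Finset.prod_le_one (fun i _ => Finset.sum_nonneg fun a _ =>
        div_nonneg (empirical_nonneg _ _) (hmn _ _)) fun i _ => ?_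
      rw [← Finset.sum_div]
      exact div_self_le_one _
  have h2 : ∀ s : Fin n → A, w (empirical fun i => (s i, y i)) s =
      2 ^ (-((n : ℝ) * condEntropy (empirical fun i => (s i, y i)))) := by
    intro s
    simp only [w, Finset.prod_div_distrib]
    have e1 := prodProb_eq_rpow (empirical_pos fun i => (s i, y i))
    have e2 := prodProb_eq_rpow (empirical_pos y)
    simp only [prodProb] at e1 e2
    rw [margSnd_empirical, e1, e2, ← Real.rpow_sub two_pos]
    congr 1
    rw [condEntropy, margSnd_empirical, entropy, entropy]
    ring
  calc _ ≤ ∑ s : Fin n → A, 2 ^ ((n : ℝ) * h) * w (empirical fun i => (s i, y i)) s := by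
        refine Finset.sum_le_sum fun s _ => ?_
        rw [h2, ← Real.rpow_add two_pos]
        split_ifs with hs
        · refine Real.one_le_rpow (by norm_num) ?_
          have := mul_le_mul_of_nonneg_left hs (Nat.cast_nonneg (α := ℝ) n)
          linarith
        · positivity
    _ ≤ _ := by
        rw [← Finset.mul_sum, mul_comm]
        gcongr

end Types

/-! ### Gibbs' inequality and lower semicontinuity of the divergence -/

section Divergence

open Topology

variable {A : Type*} [Fintype A]

/-- This is `log v ≤ v - 1` at `v = r / p`, multiplied by `p`. Summed over letters, the left side
becomes a difference of total masses. -/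
theorem sub_div_log_le {p r : ℝ} (hp : 0 ≤ p) (hr : 0 ≤ r) (h : r = 0 → p = 0) :
    (p - r) / Real.log 2 ≤ p * Real.logb 2 (p / r) := by
  have hl : 0 < Real.log 2 := Real.log_pos one_lt_two
  rcases hp.eq_or_lt with rfl | hp
  · have : (0 - r) / Real.log 2 ≤ 0 := div_nonpos_of_nonpos_of_nonneg (by linarith) hl.le
    simpa using this
  have hr' : 0 < r := lt_of_le_of_ne hr fun h0 => hp.ne' (h h0.symm)
  rw [Real.logb, ← mul_div_assoc]
  gcongr
  have h1 := Real.log_le_sub_one_of_pos (div_pos hr' hp)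
  rw [← inv_div, Real.log_inv] at h1
  have h2 := mul_le_mul_of_nonneg_left h1 hp.le
  have h3 : p * ((p / r)⁻¹ - 1) = r - p := by field_simp
  linarith

theorem sub_div_log_lt {p r : ℝ} (hp : 0 ≤ p) (hr : 0 ≤ r) (h : r = 0 → p = 0) (hne : p ≠ r) :
    (p - r) / Real.log 2 < p * Real.logb 2 (p / r) := by
  have hl : 0 < Real.log 2 := Real.log_pos one_lt_two
  rcases hp.eq_or_lt with rfl | hp
  · have : (0 - r) / Real.log 2 < 0 :=
      div_neg_of_neg_of_pos (by linarith [lt_of_le_of_ne hr hne]) hl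
    simpa using this
  have hr' : 0 < r := lt_of_le_of_ne hr fun h0 => hp.ne' (h h0.symm)
  rw [Real.logb, ← mul_div_assoc]
  gcongr
  have h1 := Real.log_lt_sub_one_of_pos (div_pos hr' hp)
    (fun h0 => hne ((div_eq_one_iff_eq hp.ne').1 h0).symm)
  rw [← inv_div, Real.log_inv] at h1
  have h2 := mul_lt_mul_of_pos_left h1 hp
  have h3 : p * ((p / r)⁻¹ - 1) = r - p := by field_simp
  linarith

/-- Only a comparison of total masses is required, so that `r` may be a sub-probability such as
`markovOf p`. -/
theorem sum_mul_logb_div_nonneg {p r : A → ℝ} (hp : ∀ a, 0 ≤ p a) (hr : ∀ a, 0 ≤ r a)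
    (h : ∀ a, r a = 0 → p a = 0) (hs : ∑ a, r a ≤ ∑ a, p a) :
    0 ≤ ∑ a, p a * Real.logb 2 (p a / r a) := by
  have h1 : ∑ a, (p a - r a) / Real.log 2 ≤ ∑ a, p a * Real.logb 2 (p a / r a) :=
    Finset.sum_le_sum fun a _ => sub_div_log_le (hp a) (hr a) (h a)
  rw [← Finset.sum_div, Finset.sum_sub_distrib] at h1
  exact (div_nonneg (sub_nonneg.2 hs) (Real.log_pos one_lt_two).le).trans h1

theorem sum_mul_logb_div_pos {p r : A → ℝ} (hp : ∀ a, 0 ≤ p a) (hr : ∀ a, 0 ≤ r a)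
    (h : ∀ a, r a = 0 → p a = 0) (hs : ∑ a, r a ≤ ∑ a, p a) (hne : p ≠ r) :
    0 < ∑ a, p a * Real.logb 2 (p a / r a) := by
  obtain ⟨a₀, ha₀⟩ := Function.ne_iff.1 hne
  have h1 : ∑ a, (p a - r a) / Real.log 2 < ∑ a, p a * Real.logb 2 (p a / r a) :=
    Finset.sum_lt_sum (fun a _ => sub_div_log_le (hp a) (hr a) (h a))
      ⟨a₀, Finset.mem_univ _, sub_div_log_lt (hp _) (hr _) (h _) ha₀⟩
  rw [← Finset.sum_div, Finset.sum_sub_distrib] at h1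
  exact (div_nonneg (sub_nonneg.2 hs) (Real.log_pos one_lt_two).le).trans_lt h1

theorem klDivergence_pos {p r : A → ℝ} (hp : p ∈ stdSimplex ℝ A) (hr : r ∈ stdSimplex ℝ A)
    (hne : p ≠ r) : 0 < klDivergence p r := by
  unfold klDivergence
  split_ifs with h
  · exact EReal.coe_pos.2 (sum_mul_logb_div_pos hp.1 hr.1 h (by rw [hp.2, hr.2]) hne)
  · exact EReal.coe_lt_top 0

/-- A continuous lower bound for the divergence. -/
def regDivergence (η : ℝ) (p r : A → ℝ) : ℝ :=
  ∑ a, (p a * Real.logb 2 (p a) - p a * Real.logb 2 (r a + η))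

theorem continuous_mul_logb : Continuous fun t : ℝ => t * Real.logb 2 t := by
  have : (fun t : ℝ => t * Real.logb 2 t) = fun t => t * Real.log t / Real.log 2 := by
    funext t
    rw [Real.logb, mul_div_assoc]
  rw [this]
  exact Real.continuous_mul_log.div_const _

theorem continuousAt_regDivergence {η : ℝ} (hη : 0 < η) {p₀ r₀ : A → ℝ} (hr : ∀ a, 0 ≤ r₀ a) :
    ContinuousAt (fun z : (A → ℝ) × (A → ℝ) => regDivergence η z.1 z.2) (p₀, r₀) := by
  unfold regDivergence
  refine tendsto_finsetSum _ fun a _ => ?_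
  refine Tendsto.sub ?_ (Tendsto.mul ?_ ?_)
  · exact (continuous_mul_logb.comp ((continuous_apply a).comp continuous_fst)).continuousAt
  · exact ((continuous_apply a).comp continuous_fst).continuousAt
  · refine Tendsto.logb ?_ (by have := hr a; positivity)
    exact (((continuous_apply a).comp continuous_snd).add continuous_const).continuousAt

theorem regDivergence_le {η : ℝ} (hη : 0 < η) {p r : A → ℝ} (hp : ∀ a, 0 ≤ p a)
    (hr : ∀ a, 0 ≤ r a) : (regDivergence η p r : EReal) ≤ klDivergence p r := by
  unfold klDivergence
  split_ifs with h
  · rw [EReal.coe_le_coe_iff]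
    refine Finset.sum_le_sum fun a _ => ?_
    rcases (hp a).eq_or_lt with ha | ha
    · simp [← ha]
    have hra : 0 < r a := lt_of_le_of_ne (hr a) fun h0 => ha.ne' (h a h0.symm)
    rw [Real.logb_div ha.ne' hra.ne', mul_sub]
    gcongr
    · norm_num
    · linarith
  · exact le_top

theorem tendsto_regDivergence {p r : A → ℝ} (h : ∀ a, r a = 0 → p a = 0) :
    Tendsto (fun η => regDivergence η p r) (𝓝[>] 0)
      (𝓝 (∑ a, p a * Real.logb 2 (p a / r a))) := by
  unfold regDivergence
  refine tendsto_finsetSum _ fun a _ => ?_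
  by_cases ha : p a = 0
  · simp [ha]
  have hra : r a ≠ 0 := fun h0 => ha (h a h0)
  rw [Real.logb_div ha hra, mul_sub]
  refine tendsto_const_nhds.sub (tendsto_const_nhds.mul ?_)
  refine Tendsto.logb ?_ hra
  have : Tendsto (fun η : ℝ => r a + η) (𝓝 0) (𝓝 (r a + 0)) := by
    apply Continuous.tendsto; fun_prop
  rw [add_zero] at this
  exact this.mono_left nhdsWithin_le_nhds

/-- The regularized divergence tends to the true one as `η ↓ 0`, even to `⊤`: a letter with `r a = 0
< p a` contributes `-p a * log η`, which is unbounded. -/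
theorem exists_lt_regDivergence {p r : A → ℝ} (hp : ∀ a, 0 ≤ p a) (hr : ∀ a, 0 ≤ r a) {d : ℝ}
    (hd : (d : EReal) < klDivergence p r) : ∃ η > 0, d < regDivergence η p r := by
  by_cases h : ∀ a, r a = 0 → p a = 0
  · rw [klDivergence, if_pos h, EReal.coe_lt_coe_iff] at hd
    obtain ⟨η, h1, h2⟩ := (((tendsto_regDivergence h).eventually (lt_mem_nhds hd)).and
      self_mem_nhdsWithin).exists
    exact ⟨η, h2, h1⟩
  · push Not at h
    obtain ⟨a, ha, hpa⟩ := h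
    have hpa' : 0 < p a := lt_of_le_of_ne (hp a) (Ne.symm hpa)
    -- Passing from regularization 1 to `η` lowers no term and raises the term of `a` by `-p a * log
    -- η`; then `η = 2^{-k}` with `k` large.
    have key : ∀ η : ℝ, 0 < η → η ≤ 1 →
        regDivergence 1 p r + p a * (-Real.logb 2 η) ≤ regDivergence η p r := by
      intro η h0 h1
      have : p a * (-Real.logb 2 η) ≤
          ∑ b, (p b * Real.logb 2 (r b + 1) - p b * Real.logb 2 (r b + η)) := by
        refine le_trans (by simp [ha]) (Finset.single_le_sum (fun b _ => ?_) (Finset.mem_univ a))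
        rw [sub_nonneg]
        have := hr b
        have := hp b
        gcongr
        norm_num
      simp only [regDivergence, Finset.sum_sub_distrib] at this ⊢
      linarith
    obtain ⟨k, hk⟩ := exists_nat_gt ((d - regDivergence 1 p r) / p a)
    have e : Real.logb 2 (2 ^ (-(k : ℝ))) = -k := Real.logb_rpow (by norm_num) (by norm_num)
    refine ⟨2 ^ (-(k : ℝ)), by positivity, lt_of_lt_of_le ?_ (key _ (by positivity)
      (Real.rpow_le_one_of_one_le_of_nonpos (by norm_num) (by simp)))⟩
    rw [e, neg_neg]
    rw [div_lt_iff₀ hpa'] at hk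
    linarith

/-- Joint lower semicontinuity of the divergence, made uniform on the simplex. -/
theorem eventually_forall_lt_klDivergence {T : Type*} [TopologicalSpace T] {t₀ : T}
    {r : T → A → ℝ} (hr : ContinuousAt r t₀) (hr₀ : ∀ a, 0 ≤ r t₀ a) {d : T → ℝ}
    (hd : ContinuousAt d t₀) {K : T → (A → ℝ) → Prop}
    (hK : ∀ p, ¬ K t₀ p → ∀ᶠ z in 𝓝 (t₀, p), ¬ K z.1 z.2)
    (h : ∀ p ∈ stdSimplex ℝ A, K t₀ p → (d t₀ : EReal) < klDivergence p (r t₀)) :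
    ∀ᶠ t in 𝓝 t₀, ∀ p ∈ stdSimplex ℝ A, (∀ a, 0 ≤ r t a) → K t p →
      (d t : EReal) < klDivergence p (r t) := by
  -- By compactness it is enough to work near each point `(t₀, p)`. If `K t₀ p` holds, a continuous
  -- regularization already exceeds `d` nearby; otherwise `K` fails nearby.
  have := (isCompact_stdSimplex ℝ A).eventually_forall_of_forall_eventually (x₀ := t₀)
    (P := fun t p => p ∈ stdSimplex ℝ A → (∀ a, 0 ≤ r t a) → K t p →
      (d t : EReal) < klDivergence p (r t)) ?_
  · filter_upwards [this] with t ht p hp using ht p hp hp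
  intro p hp
  by_cases hKp : K t₀ p
  · obtain ⟨η, hη, hlt⟩ := exists_lt_regDivergence hp.1 hr₀ (h p hp hKp)
    have c1 : ContinuousAt (fun z : T × (A → ℝ) => regDivergence η z.2 (r z.1)) (t₀, p) := by
      refine ContinuousAt.comp (f := fun z : T × (A → ℝ) => (z.2, r z.1))
        (continuousAt_regDivergence hη hr₀) ?_
      exact continuous_snd.continuousAt.prodMk (hr.comp (x := (t₀, p)) continuous_fst.continuousAt)
    have c2 : ContinuousAt (fun z : T × (A → ℝ) => d z.1) (t₀, p) :=
      hd.comp (x := (t₀, p)) continuous_fst.continuousAt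
    filter_upwards [c2.eventually_lt c1 hlt] with z hz hz1 hz2 _
    exact lt_of_lt_of_le (EReal.coe_lt_coe_iff.2 hz) (regDivergence_le hη hz1.1 hz2)
  · filter_upwards [hK p hKp] with z hz _ _ hz3 using absurd hz3 hz

theorem exists_pos_le_klDivergence {r : A → ℝ} (hr : r ∈ stdSimplex ℝ A)
    {N : Set (A → ℝ)} (hN : IsOpen N) (hrN : r ∈ N) :
    ∃ c : ℝ, 0 < c ∧ ∀ p ∈ stdSimplex ℝ A, p ∉ N → (c : EReal) ≤ klDivergence p r := by
  -- With the bound `d t = t`, strict positivity of the divergence at `t = 0` persists for some `t >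
  -- 0`, and this `t` is the uniform exponent.
  have h := eventually_forall_lt_klDivergence (T := ℝ) (t₀ := 0) (r := fun _ => r)
    (d := fun t => t) (K := fun _ p => p ∉ N) continuousAt_const hr.1 continuousAt_id
    (fun p hp => by
      have : ∀ᶠ q in 𝓝 p, q ∈ N := hN.mem_nhds (not_not.1 hp)
      have h2 := (continuous_snd (X := ℝ) (Y := A → ℝ)).continuousAt (x := (0, p)) |>.eventually
        this
      filter_upwards [h2] with z hz
      exact not_not.2 hz)
    (fun p hp hpN => klDivergence_pos hp hr fun h0 => hpN (h0 ▸ hrN))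
  obtain ⟨c, hc, hc0⟩ := ((h.filter_mono nhdsWithin_le_nhds).and
    (self_mem_nhdsWithin (a := (0 : ℝ)) (s := Set.Ioi 0))).exists
  exact ⟨c, hc0, fun p hp hpN => (hc p hp hr.1 hpN).le⟩

end Divergence

/-! ### Continuity of marginals and entropies -/

section Continuity

variable {A B S X Y : Type*} [Fintype A] [Fintype B] [Fintype S] [Fintype X] [Fintype Y]

theorem continuous_entropy : Continuous (entropy : (A → ℝ) → ℝ) :=
  (continuous_finsetSum _ fun a _ => continuous_mul_logb.comp (continuous_apply a)).neg

theorem continuous_margFst : Continuous (margFst : (A × B → ℝ) → A → ℝ) :=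
  continuous_pi fun _ => continuous_finsetSum _ fun _ _ => continuous_apply _

theorem continuous_margSnd : Continuous (margSnd : (A × B → ℝ) → B → ℝ) :=
  continuous_pi fun _ => continuous_finsetSum _ fun _ _ => continuous_apply _

theorem continuous_margSX : Continuous (margSX : (S × X × Y → ℝ) → S × X → ℝ) :=
  continuous_pi fun _ => continuous_finsetSum _ fun _ _ => continuous_apply _

theorem continuous_margSY : Continuous (margSY : (S × X × Y → ℝ) → S × Y → ℝ) :=
  continuous_pi fun _ => continuous_finsetSum _ fun _ _ => continuous_apply _

theorem continuous_margY : Continuous (margY : (S × X × Y → ℝ) → Y → ℝ) :=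
  continuous_margSnd.comp continuous_margSnd

theorem continuous_condEntropy : Continuous (condEntropy : (A × B → ℝ) → ℝ) :=
  continuous_entropy.sub (continuous_entropy.comp continuous_margSnd)

end Continuity

/-! ### Information quantities as divergences -/

section Identities

variable {A B S X Y : Type*} [Fintype A] [Fintype B] [Fintype S] [Fintype X] [Fintype Y]

theorem margSX_empirical {n : ℕ} (s : Fin n → S) (x : Fin n → X) (y : Fin n → Y) :
    margSX (empirical fun i => (s i, x i, y i)) = empirical fun i => (s i, x i) := by
  classical
  funext a
  simp only [margSX, empirical, ← Finset.sum_div, Prod.mk.injEq]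
  rw [Finset.sum_comm]
  congr 1
  refine Finset.sum_congr rfl fun i _ => ?_
  by_cases h : s i = a.1 <;> by_cases h' : x i = a.2 <;> simp [h, h', Prod.ext_iff]

theorem margSY_empirical {n : ℕ} (s : Fin n → S) (x : Fin n → X) (y : Fin n → Y) :
    margSY (empirical fun i => (s i, x i, y i)) = empirical fun i => (s i, y i) := by
  classical
  funext a
  simp only [margSY, empirical, ← Finset.sum_div, Prod.mk.injEq]
  rw [Finset.sum_comm]
  congr 1
  refine Finset.sum_congr rfl fun i _ => ?_
  by_cases h : s i = a.1 <;> by_cases h' : y i = a.2 <;> simp [h, h', Prod.ext_iff]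

theorem margY_empirical {n : ℕ} (s : Fin n → S) (x : Fin n → X) (y : Fin n → Y) :
    margY (empirical fun i => (s i, x i, y i)) = empirical y := by
  rw [margY, margXY, margSnd_empirical, margSnd_empirical]

theorem margSnd_margSY (p : S × X × Y → ℝ) : margSnd (margSY p) = margY p := by
  funext y
  simp only [margSnd, margSY, margY, margXY]
  exact Finset.sum_comm

theorem margFst_margSY (p : S × X × Y → ℝ) : margFst (margSY p) = margFst (margSX p) := by
  funext s
  simp only [margFst, margSY, margSX]
  exact Finset.sum_comm

/-- Marginal entropies are written as sums over the full alphabet so that information identities can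
be checked letter by letter. -/
theorem entropy_margFst (p : A × B → ℝ) :
    entropy (margFst p) = -∑ a, p a * Real.logb 2 (margFst p a.1) := by
  simp only [entropy, Fintype.sum_prod_type, ← Finset.sum_mul]
  rfl

theorem entropy_margSnd (p : A × B → ℝ) :
    entropy (margSnd p) = -∑ a, p a * Real.logb 2 (margSnd p a.2) := by
  simp only [entropy, Fintype.sum_prod_type]
  rw [Finset.sum_comm]
  simp only [← Finset.sum_mul]
  rfl

theorem entropy_margSY (p : S × X × Y → ℝ) :
    entropy (margSY p) = -∑ a, p a * Real.logb 2 (margSY p (a.1, a.2.2)) := by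
  simp only [entropy, Fintype.sum_prod_type]
  congr 1
  refine Finset.sum_congr rfl fun s _ => ?_
  rw [Finset.sum_comm]
  simp only [← Finset.sum_mul]
  rfl

theorem entropy_margY (p : S × X × Y → ℝ) :
    entropy (margY p) = -∑ a, p a * Real.logb 2 (margY p a.2.2) := by
  rw [← margSnd_margSY, entropy_margSnd]
  simp only [Fintype.sum_prod_type]
  congr 1
  refine Finset.sum_congr rfl fun s _ => ?_
  rw [Finset.sum_comm]
  simp only [← Finset.sum_mul]
  rfl

theorem mutualInfo_eq {p : A × B → ℝ} (hp : ∀ a, 0 ≤ p a) :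
    mutualInfo p = ∑ a, p a * Real.logb 2 (p a / (margFst p a.1 * margSnd p a.2)) := by
  rw [mutualInfo, condEntropy, entropy_margFst, entropy_margSnd, entropy, ← sub_eq_zero]
  simp only [← Finset.sum_neg_distrib, ← Finset.sum_sub_distrib]
  refine Finset.sum_eq_zero fun a _ => ?_
  rcases (hp a).eq_or_lt with h | h
  · simp [← h]
  have h1 : 0 < margFst p a.1 := h.trans_le
    (Finset.single_le_sum (f := fun b => p (a.1, b)) (fun b _ => hp _) (Finset.mem_univ a.2))
  have h2 : 0 < margSnd p a.2 := h.trans_le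
    (Finset.single_le_sum (f := fun b => p (b, a.2)) (fun b _ => hp _) (Finset.mem_univ a.1))
  rw [Real.logb_div h.ne' (by positivity), Real.logb_mul h1.ne' h2.ne']
  ring

/-- The pmf `P_{XY} P_{S|Y}` of `(S, X, Y)`. -/
def markovOf (p : S × X × Y → ℝ) : S × X × Y → ℝ :=
  fun a => margXY p a.2 * margSY p (a.1, a.2.2) / margY p a.2.2

theorem marg_pos_of_pos {p : S × X × Y → ℝ} (hp : ∀ a, 0 ≤ p a) {a : S × X × Y} (h : 0 < p a) :
    0 < margXY p a.2 ∧ 0 < margSY p (a.1, a.2.2) ∧ 0 < margY p a.2.2 := by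
  have h1 : 0 < margXY p a.2 := h.trans_le
    (Finset.single_le_sum (f := fun b => p (b, a.2)) (fun b _ => hp _) (Finset.mem_univ a.1))
  refine ⟨h1, h.trans_le (Finset.single_le_sum (f := fun b => p (a.1, b, a.2.2))
    (fun b _ => hp _) (Finset.mem_univ a.2.1)), h1.trans_le ?_⟩
  exact Finset.single_le_sum (f := fun b => margXY p (b, a.2.2))
    (fun b _ => Finset.sum_nonneg fun s _ => hp _) (Finset.mem_univ a.2.1)

theorem markovOf_nonneg {p : S × X × Y → ℝ} (hp : ∀ a, 0 ≤ p a) (a : S × X × Y) :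
    0 ≤ markovOf p a := by
  refine div_nonneg (mul_nonneg ?_ ?_) ?_
  · exact Finset.sum_nonneg fun s _ => hp _
  · exact Finset.sum_nonneg fun s _ => hp _
  · exact Finset.sum_nonneg fun s _ => Finset.sum_nonneg fun s _ => hp _

theorem eq_zero_of_markovOf {p : S × X × Y → ℝ} (hp : ∀ a, 0 ≤ p a) {a : S × X × Y}
    (h : markovOf p a = 0) : p a = 0 := by
  by_contra hne
  obtain ⟨h1, h2, h3⟩ := marg_pos_of_pos hp (lt_of_le_of_ne (hp a) (Ne.symm hne))
  exact (div_pos (mul_pos h1 h2) h3).ne' h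

theorem condMutualInfo_eq {p : S × X × Y → ℝ} (hp : ∀ a, 0 ≤ p a) :
    condMutualInfo p = ∑ a, p a * Real.logb 2 (p a / markovOf p a) := by
  rw [condMutualInfo, condEntropy, condEntropy, margSnd_margSY, entropy_margSY, entropy_margY,
    entropy_margSnd p, entropy, ← sub_eq_zero]
  simp only [← Finset.sum_neg_distrib, ← Finset.sum_sub_distrib]
  refine Finset.sum_eq_zero fun a _ => ?_
  rcases (hp a).eq_or_lt with h | h
  · simp [← h]
  obtain ⟨h1, h2, h3⟩ := marg_pos_of_pos hp h
  rw [markovOf, Real.logb_div h.ne' (by positivity), Real.logb_div (by positivity) h3.ne',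
    Real.logb_mul h1.ne' h2.ne']
  simp only [margXY]
  ring

/-- Summing over `s` first leaves the factor `margY p / margY p`, at most 1 with the convention `0 /
0 = 0`. The inequality is all that Gibbs' inequality needs. -/
theorem sum_markovOf_le {p : S × X × Y → ℝ} (hp : ∀ a, 0 ≤ p a) :
    ∑ a, markovOf p a ≤ ∑ a, p a := by
  have h1 : ∑ a, p a = ∑ z, margXY p z := by
    rw [Fintype.sum_prod_type, Finset.sum_comm]
    rfl
  rw [h1, Fintype.sum_prod_type, Finset.sum_comm]
  refine Finset.sum_le_sum fun z _ => ?_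
  have h2 : 0 ≤ margXY p z := Finset.sum_nonneg fun s _ => hp _
  have h3 : ∑ s, margSY p (s, z.2) = margY p z.2 := congrFun (margSnd_margSY p) z.2
  simp only [markovOf]
  rw [← Finset.sum_div, ← Finset.mul_sum, h3, mul_div_assoc]
  exact mul_le_of_le_one_right h2 (div_self_le_one _)

theorem condMutualInfo_nonneg {p : S × X × Y → ℝ} (hp : ∀ a, 0 ≤ p a) :
    0 ≤ condMutualInfo p := by
  rw [condMutualInfo_eq hp]
  exact sum_mul_logb_div_nonneg hp (markovOf_nonneg hp) (fun a => eq_zero_of_markovOf hp)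
    (sum_markovOf_le hp)

theorem sum_margFst (p : A × B → ℝ) : ∑ a, margFst p a = ∑ a, p a :=
  (Fintype.sum_prod_type _).symm

theorem sum_margSnd (p : A × B → ℝ) : ∑ a, margSnd p a = ∑ a, p a := by
  rw [Fintype.sum_prod_type, Finset.sum_comm]
  rfl

theorem margFst_mem {p : A × B → ℝ} (hp : p ∈ stdSimplex ℝ (A × B)) :
    margFst p ∈ stdSimplex ℝ A :=
  ⟨fun _ => Finset.sum_nonneg fun _ _ => hp.1 _, by rw [sum_margFst, hp.2]⟩

theorem margSnd_mem {p : A × B → ℝ} (hp : p ∈ stdSimplex ℝ (A × B)) :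
    margSnd p ∈ stdSimplex ℝ B :=
  ⟨fun _ => Finset.sum_nonneg fun _ _ => hp.1 _, by rw [sum_margSnd, hp.2]⟩

theorem prod_margins_mem {p : A × B → ℝ} (hp : p ∈ stdSimplex ℝ (A × B)) :
    (fun a : A × B => margFst p a.1 * margSnd p a.2) ∈ stdSimplex ℝ (A × B) := by
  refine ⟨fun a => mul_nonneg ((margFst_mem hp).1 _) ((margSnd_mem hp).1 _), ?_⟩
  rw [Fintype.sum_prod_type]
  simp only [← Finset.mul_sum, (margSnd_mem hp).2, mul_one, (margFst_mem hp).2]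

theorem eq_zero_of_prod_margins {p : A × B → ℝ} (hp : ∀ a, 0 ≤ p a) {a : A × B}
    (h : margFst p a.1 * margSnd p a.2 = 0) : p a = 0 := by
  by_contra hne
  have h0 : 0 < p a := lt_of_le_of_ne (hp a) (Ne.symm hne)
  have h1 : 0 < margFst p a.1 := h0.trans_le
    (Finset.single_le_sum (f := fun b => p (a.1, b)) (fun b _ => hp _) (Finset.mem_univ a.2))
  have h2 : 0 < margSnd p a.2 := h0.trans_le
    (Finset.single_le_sum (f := fun b => p (b, a.2)) (fun b _ => hp _) (Finset.mem_univ a.1))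
  exact (mul_pos h1 h2).ne' h

theorem mutualInfo_nonneg {p : A × B → ℝ} (hp : p ∈ stdSimplex ℝ (A × B)) :
    0 ≤ mutualInfo p := by
  rw [mutualInfo_eq hp.1]
  exact sum_mul_logb_div_nonneg hp.1 (prod_margins_mem hp).1
    (fun a => eq_zero_of_prod_margins hp.1) (by rw [hp.2, (prod_margins_mem hp).2])

/-- The equality case of Gibbs' inequality, needed at rate zero. -/
theorem eq_prod_margins_of_mutualInfo_nonpos {p : A × B → ℝ} (hp : p ∈ stdSimplex ℝ (A × B))
    (h : mutualInfo p ≤ 0) : p = fun a => margFst p a.1 * margSnd p a.2 := by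
  by_contra hne
  rw [mutualInfo_eq hp.1] at h
  exact absurd h (not_le.2 (sum_mul_logb_div_pos hp.1 (prod_margins_mem hp).1
    (fun a => eq_zero_of_prod_margins hp.1) (by rw [hp.2, (prod_margins_mem hp).2]) hne))

/-- The log-sum inequality for two terms. -/
theorem log_sum_two {a₁ a₂ b₁ b₂ : ℝ} (ha₁ : 0 ≤ a₁) (ha₂ : 0 ≤ a₂) (hb₁ : 0 ≤ b₁)
    (hb₂ : 0 ≤ b₂) (h₁ : b₁ = 0 → a₁ = 0) (h₂ : b₂ = 0 → a₂ = 0) :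
    (a₁ + a₂) * Real.logb 2 ((a₁ + a₂) / (b₁ + b₂)) ≤
      a₁ * Real.logb 2 (a₁ / b₁) + a₂ * Real.logb 2 (a₂ / b₂) := by
  rcases (add_nonneg ha₁ ha₂).eq_or_lt with h0 | h0
  · have e1 : a₁ = 0 := by linarith
    have e2 : a₂ = 0 := by linarith
    simp [e1, e2]
  have hb : 0 < b₁ + b₂ := by
    refine lt_of_le_of_ne (add_nonneg hb₁ hb₂) fun hb => ?_
    have := h₁ (by linarith)
    have := h₂ (by linarith)
    linarith
  -- Each `aᵢ` is compared with `bᵢ` rescaled to the total mass `a₁ + a₂`; the two linear deficits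
  -- then cancel.
  have key : ∀ a b : ℝ, 0 ≤ a → 0 ≤ b → (b = 0 → a = 0) →
      (a - b * ((a₁ + a₂) / (b₁ + b₂))) / Real.log 2 ≤
        a * Real.logb 2 (a / b) - a * Real.logb 2 ((a₁ + a₂) / (b₁ + b₂)) := by
    intro a b ha hb' hab
    have hq : 0 < (a₁ + a₂) / (b₁ + b₂) := div_pos h0 hb
    refine (sub_div_log_le ha (mul_nonneg hb' hq.le) fun h => hab ?_).trans_eq ?_
    · exact (mul_eq_zero.1 h).resolve_right hq.ne'
    rcases ha.eq_or_lt with rfl | ha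
    · simp
    have hb0 : b ≠ 0 := fun h => ha.ne' (hab h)
    rw [← div_div, Real.logb_div (by positivity) hq.ne', mul_sub]
  have k1 := key a₁ b₁ ha₁ hb₁ h₁
  have k2 := key a₂ b₂ ha₂ hb₂ h₂
  have e : (a₁ - b₁ * ((a₁ + a₂) / (b₁ + b₂))) / Real.log 2 +
      (a₂ - b₂ * ((a₁ + a₂) / (b₁ + b₂))) / Real.log 2 = 0 := by
    field_simp
    ring
  linarith [add_le_add k1 k2]

end Identities

/-! ### The Markov chain `S - X - Y` -/

section Channel

variable {S X Y Z : Type*} [Fintype S] [Fintype X] [Fintype Y] [Fintype Z]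

theorem joint_nonneg {W : X → S → ℝ} {P : X × Y → ℝ} (hP : ∀ a, 0 ≤ P a)
    (hW : ∀ x s, 0 ≤ W x s) (a : S × X × Y) : 0 ≤ joint W P a :=
  mul_nonneg (hW _ _) (hP _)

theorem margXY_joint {W : X → S → ℝ} (P : X × Y → ℝ) (hW : ∀ x, ∑ s, W x s = 1) :
    margXY (joint W P) = P := by
  funext z
  simp only [margXY, margSnd, joint, ← Finset.sum_mul, hW, one_mul]

theorem margSX_joint (W : X → S → ℝ) (P : X × Y → ℝ) :
    margSX (joint W P) = fun a => W a.2 a.1 * margFst P a.2 := by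
  funext a
  simp only [margSX, joint, ← Finset.mul_sum, margFst]

theorem joint_mem {W : X → S → ℝ} {P : X × Y → ℝ} (hP : P ∈ stdSimplex ℝ (X × Y))
    (hW : ∀ x, W x ∈ stdSimplex ℝ S) : joint W P ∈ stdSimplex ℝ (S × X × Y) := by
  refine ⟨joint_nonneg hP.1 fun x => (hW x).1, ?_⟩
  rw [← sum_margSnd]
  change ∑ a, margXY (joint W P) a = 1
  rw [margXY_joint P fun x => (hW x).2, hP.2]

theorem margSX_mem {p : S × X × Y → ℝ} (hp : p ∈ stdSimplex ℝ (S × X × Y)) :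
    margSX p ∈ stdSimplex ℝ (S × X) := by
  refine ⟨fun _ => Finset.sum_nonneg fun _ _ => hp.1 _, ?_⟩
  rw [← hp.2]
  simp only [margSX, Fintype.sum_prod_type]

theorem margSY_mem {p : S × X × Y → ℝ} (hp : p ∈ stdSimplex ℝ (S × X × Y)) :
    margSY p ∈ stdSimplex ℝ (S × Y) := by
  refine ⟨fun _ => Finset.sum_nonneg fun _ _ => hp.1 _, ?_⟩
  rw [← hp.2]
  simp only [margSY, Fintype.sum_prod_type]
  exact Finset.sum_congr rfl fun s _ => Finset.sum_comm

theorem condEntropy_channel {V : Z → S → ℝ} {q : Z → ℝ} (hV : ∀ z, ∑ s, V z s = 1) :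
    condEntropy (fun a : S × Z => V a.2 a.1 * q a.2) = ∑ z, q z * entropy (V z) := by
  have hm : margSnd (fun a : S × Z => V a.2 a.1 * q a.2) = q := by
    funext z
    simp only [margSnd, ← Finset.sum_mul, hV, one_mul]
  rw [condEntropy, hm]
  have e : ∀ w p : ℝ, w * p * Real.logb 2 (w * p) =
      p * (w * Real.logb 2 w) + w * (p * Real.logb 2 p) := by
    intro w p
    by_cases hw : w = 0
    · simp [hw]
    by_cases hp : p = 0
    · simp [hp]
    rw [Real.logb_mul hw hp]
    ring
  simp only [entropy, e, Fintype.sum_prod_type, Finset.sum_add_distrib]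
  rw [Finset.sum_comm, Finset.sum_comm (f := fun s z => V z s * (q z * Real.logb 2 (q z)))]
  simp only [← Finset.mul_sum, ← Finset.sum_mul, hV, one_mul, mul_neg, Finset.sum_neg_distrib]
  ring

/-- `S` depends on `(X, Y)` through `X` alone, hence `H(S|X,Y) = H(S|X)`, which involves only the
`X`-marginal of `P`. -/
theorem condEntropy_joint {W : X → S → ℝ} (P : X × Y → ℝ) (hW : ∀ x, ∑ s, W x s = 1) :
    condEntropy (joint W P) = ∑ x, margFst P x * entropy (W x) := by
  have := condEntropy_channel (V := fun z : X × Y => W z.1) (q := P) (fun z => hW z.1)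
  rw [show joint W P = fun a : S × X × Y => W a.2.1 a.1 * P a.2 from rfl, this,
    Fintype.sum_prod_type]
  simp only [← Finset.sum_mul, margFst]

theorem condEntropy_margSX_joint {W : X → S → ℝ} (P : X × Y → ℝ) (hW : ∀ x, ∑ s, W x s = 1) :
    condEntropy (margSX (joint W P)) = ∑ x, margFst P x * entropy (W x) := by
  rw [margSX_joint]
  exact condEntropy_channel hW

/-- Both sides equal `H(S|Y) - H(S|X)` by the Markov property. This identity turns the binning cost
into `R - I(S;X|Y)`. -/
theorem condMutualInfo_joint {W : X → S → ℝ} (P : X × Y → ℝ) (hW : ∀ x, ∑ s, W x s = 1) :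
    condMutualInfo (joint W P) =
      mutualInfo (margSX (joint W P)) - mutualInfo (margSY (joint W P)) := by
  rw [condMutualInfo, mutualInfo, mutualInfo, condEntropy_joint P hW,
    condEntropy_margSX_joint P hW, margFst_margSY]
  ring

end Channel

/-! ### Random codebooks and the one-shot bound -/

section RandomCoding

open Classical in
/-- The indicator of a proposition. -/
def ind (p : Prop) : ℝ := if p then 1 else 0

theorem ind_nonneg (p : Prop) : 0 ≤ ind p := by unfold ind; positivity

theorem ind_le_one (p : Prop) : ind p ≤ 1 := by unfold ind; split_ifs <;> norm_num

theorem ind_of {p : Prop} (h : p) : ind p = 1 := if_pos h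

theorem ind_of_not {p : Prop} (h : ¬ p) : ind p = 0 := if_neg h

theorem ind_and (p q : Prop) : ind (p ∧ q) = ind p * ind q := by
  by_cases hp : p <;> by_cases hq : q <;> simp [ind, hp, hq]

variable {J U : Type*} [Fintype J] [DecidableEq J] [Fintype U]

/-- Codewords are independent, so expectations of products factorize. The moments below take all
factors but one or two equal to 1, or all equal to one indicator. -/
theorem codebook_sum_prod (π : U → ℝ) (f : J → U → ℝ) :
    ∑ C : J → U, (∏ j, π (C j)) * ∏ j, f j (C j) = ∏ j, ∑ u, π u * f j u := by
  classical
  have e := (Finset.prod_univ_sum (fun _ : J => (Finset.univ : Finset U))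
    (fun j u => π u * f j u)).symm
  simp only [Fintype.piFinset_univ] at e
  rw [← e]
  exact Finset.sum_congr rfl fun C _ => Finset.prod_mul_distrib.symm

theorem codebook_sum {π : U → ℝ} (hπ : ∑ u, π u = 1) : ∑ C : J → U, ∏ j, π (C j) = 1 := by
  simpa [hπ] using codebook_sum_prod (J := J) π (fun _ _ => 1)

theorem codebook_sum_one {π : U → ℝ} (hπ : ∑ u, π u = 1) (g : U → ℝ) (j : J) :
    ∑ C : J → U, (∏ j, π (C j)) * g (C j) = ∑ u, π u * g u := by
  classical
  have h := codebook_sum_prod π (fun k u => if k = j then g u else 1)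
  have e : ∀ k, ∑ u, π u * (if k = j then g u else 1) =
      if k = j then ∑ u, π u * g u else 1 := by
    intro k
    split_ifs <;> simp [hπ]
  simp only [e] at h
  simpa using h

theorem codebook_sum_two {π : U → ℝ} (hπ : ∑ u, π u = 1) (g h : U → ℝ) {j k : J} (hjk : j ≠ k) :
    ∑ C : J → U, (∏ j, π (C j)) * (g (C j) * h (C k)) =
      (∑ u, π u * g u) * ∑ u, π u * h u := by
  classical
  have h0 := codebook_sum_prod π (fun i u => (if i = j then g u else 1) *
    (if i = k then h u else 1))
  have e : ∀ i, ∑ u, π u * ((if i = j then g u else 1) * (if i = k then h u else 1)) =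
      (if i = j then ∑ u, π u * g u else 1) * (if i = k then ∑ u, π u * h u else 1) := by
    intro i
    by_cases h1 : i = j
    · subst h1
      simp [hjk]
    · by_cases h2 : i = k
      · simp [h2, hjk.symm]
      · simp [h1, h2, hπ]
  simp only [e, Finset.prod_mul_distrib] at h0
  simpa only [Finset.prod_ite_eq', Finset.mem_univ, if_true] using h0

theorem codebook_sum_none {π : U → ℝ} (hπ : ∑ u, π u = 1) (T : U → Prop) :
    ∑ C : J → U, (∏ j, π (C j)) * ind (∀ j, ¬ T (C j)) =
      (1 - ∑ u, π u * ind (T u)) ^ Fintype.card J := by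
  have h := codebook_sum_prod (J := J) π (fun _ u => ind (¬ T u))
  have e1 : ∀ C : J → U, ∏ j, ind (¬ T (C j)) = ind (∀ j, ¬ T (C j)) := by
    intro C
    by_cases hC : ∀ j, ¬ T (C j)
    · rw [ind_of hC]
      exact Finset.prod_eq_one fun j _ => ind_of (hC j)
    · rw [ind_of_not hC]
      push Not at hC
      obtain ⟨j, hj⟩ := hC
      exact Finset.prod_eq_zero (Finset.mem_univ j) (ind_of_not (not_not.2 hj))
  have e2 : ∑ u, π u * ind (¬ T u) = 1 - ∑ u, π u * ind (T u) := by
    rw [← hπ, ← Finset.sum_sub_distrib]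
    refine Finset.sum_congr rfl fun u _ => ?_
    by_cases hu : T u <;> simp [ind, hu]
  simpa [e1, e2] using h

variable {𝒳 𝒴 : Type*} {B L : ℕ}

/-- The quantize-and-bin code of a codebook. -/
theorem exists_code_of_codebook (T₁ : U → 𝒳 → Prop) (T₂ G : U → 𝒴 → Prop)
    (hTG : ∀ u y, T₂ u y → ¬ G u y) (C : Fin B × Fin L → U) :
    ∃ (e : 𝒳 → Fin (B + 1)) (g : 𝒴 → Fin (B + 1) → Fin 2), ∀ x y,
      ind (g y (e x) = 1) ≤ ind (∀ j, ¬ T₁ (C j) x) + ∑ j, ind (T₁ (C j) x ∧ ¬ T₂ (C j) y) +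
        ∑ j, ∑ l ∈ Finset.univ.erase j.2, ind (T₁ (C j) x) * ind (G (C (j.1, l)) y) ∧
      ind (g y (e x) = 0) ≤ ∑ j, ind (T₁ (C j) x ∧ T₂ (C j) y) +
        ∑ j, ∑ l ∈ Finset.univ.erase j.2,
          ind (T₁ (C j) x ∧ ¬ G (C j) y) * ind (T₂ (C (j.1, l)) y) := by
  classical
  -- Forbidding `G` on the whole bin ensures that, upon acceptance, the encoder's own codeword
  -- satisfies `¬ G` even when another codeword triggered the acceptance.
  let acc : 𝒴 → Fin B → Prop := fun y b => (∃ l, T₂ (C (b, l)) y) ∧ ∀ l, ¬ G (C (b, l)) y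
  -- Message 0 signals that no codeword covers `x` and leads to rejection; bin `b` is sent as
  -- `b.succ`.
  let e : 𝒳 → Fin (B + 1) := fun x =>
    if h : ∃ j, T₁ (C j) x then (Classical.choose h).1.succ else 0
  let g : 𝒴 → Fin (B + 1) → Fin 2 := fun y m =>
    Fin.cases (motive := fun _ => Fin 2) 1 (fun b => if acc y b then 0 else 1) m
  refine ⟨e, g, fun x y => ?_⟩
  have n1 : 0 ≤ ∑ j, ind (T₁ (C j) x ∧ ¬ T₂ (C j) y) := Finset.sum_nonneg fun j _ => ind_nonneg _
  have n2 : 0 ≤ ∑ j : Fin B × Fin L, ∑ l ∈ Finset.univ.erase j.2,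
      ind (T₁ (C j) x) * ind (G (C (j.1, l)) y) :=
    Finset.sum_nonneg fun j _ => Finset.sum_nonneg fun l _ =>
      mul_nonneg (ind_nonneg _) (ind_nonneg _)
  have n3 : 0 ≤ ∑ j, ind (T₁ (C j) x ∧ T₂ (C j) y) := Finset.sum_nonneg fun j _ => ind_nonneg _
  have n4 : 0 ≤ ∑ j : Fin B × Fin L, ∑ l ∈ Finset.univ.erase j.2,
      ind (T₁ (C j) x ∧ ¬ G (C j) y) * ind (T₂ (C (j.1, l)) y) :=
    Finset.sum_nonneg fun j _ => Finset.sum_nonneg fun l _ =>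
      mul_nonneg (ind_nonneg _) (ind_nonneg _)
  by_cases hx : ∃ j, T₁ (C j) x
  · set j := Classical.choose hx with hj
    have hTj : T₁ (C j) x := Classical.choose_spec hx
    have he : e x = j.1.succ := dif_pos hx
    have hg : g y (e x) = if acc y j.1 then 0 else 1 := by rw [he]; rfl
    have p1 : ∀ f : Fin B × Fin L → Prop, f j → 1 ≤ ∑ j, ind (f j) := fun f hf =>
      (ind_of hf).symm.le.trans
        (Finset.single_le_sum (fun k _ => ind_nonneg (f k)) (Finset.mem_univ j))
    have p2 : ∀ (f f' : Fin B × Fin L → Prop) (l : Fin L), f j → l ≠ j.2 → f' (j.1, l) →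
        1 ≤ ∑ j : Fin B × Fin L, ∑ l ∈ Finset.univ.erase j.2, ind (f j) * ind (f' (j.1, l)) := by
      intro f f' l hf hl hf'
      refine le_trans ?_ (Finset.single_le_sum (fun k _ => Finset.sum_nonneg fun l _ =>
        mul_nonneg (ind_nonneg _) (ind_nonneg _)) (Finset.mem_univ j))
      refine le_trans ?_ (Finset.single_le_sum (fun l _ =>
        mul_nonneg (ind_nonneg _) (ind_nonneg _))
        (Finset.mem_erase.2 ⟨hl, Finset.mem_univ l⟩))
      rw [ind_of hf, ind_of hf', one_mul]
    constructor
    · by_cases ha : acc y j.1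
      · rw [ind_of_not (by rw [hg, if_pos ha]; decide)]
        have := ind_nonneg (∀ j, ¬ T₁ (C j) x)
        positivity
      rw [ind_of (by rw [hg, if_neg ha])]
      have n0 := ind_nonneg (∀ j, ¬ T₁ (C j) x)
      by_cases h2 : T₂ (C j) y
      · have : ∃ l, G (C (j.1, l)) y := by
          by_contra! hc
          exact ha ⟨⟨j.2, h2⟩, hc⟩
        obtain ⟨l, hl⟩ := this
        -- The chosen codeword satisfies `T₂`, which excludes `G`, so the offending codeword is
        -- another one.
        have hlj : l ≠ j.2 := by
          rintro rfl
          exact hTG _ _ h2 hl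
        have := p2 (fun j => T₁ (C j) x) (fun j => G (C j) y) l hTj hlj hl
        linarith
      · have := p1 (fun j => T₁ (C j) x ∧ ¬ T₂ (C j) y) ⟨hTj, h2⟩
        linarith
    · by_cases ha : acc y j.1
      · refine (ind_le_one _).trans ?_
        obtain ⟨⟨l, hl⟩, hG⟩ := ha
        by_cases hlj : l = j.2
        · subst hlj
          have := p1 (fun j => T₁ (C j) x ∧ T₂ (C j) y) ⟨hTj, hl⟩
          linarith
        · have := p2 (fun j => T₁ (C j) x ∧ ¬ G (C j) y) (fun j => T₂ (C j) y) l
            ⟨hTj, hG j.2⟩ hlj hl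
          linarith
      · rw [ind_of_not (by rw [hg, if_neg ha]; decide)]
        linarith
  · have he : e x = 0 := dif_neg hx
    have hg : g y (e x) = 1 := by rw [he]; rfl
    push Not at hx
    constructor
    · rw [ind_of hx]
      linarith [ind_le_one (g y (e x) = 1)]
    · rw [ind_of_not (by rw [hg]; decide)]
      linarith

variable [Fintype 𝒳] [Fintype 𝒴]

/-- Each codeword has `L - 1` independent competitors in its bin, and none when `L = 1`. -/
theorem codebook_sum_pairs {π : U → ℝ} (hπ : ∑ u, π u = 1) (g h : U → ℝ) :
    ∑ C : Fin B × Fin L → U, (∏ j, π (C j)) *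
        ∑ j : Fin B × Fin L, ∑ l ∈ Finset.univ.erase j.2, g (C j) * h (C (j.1, l)) =
      (B * L : ℕ) * ((L - 1 : ℕ) * ((∑ u, π u * g u) * ∑ u, π u * h u)) := by
  simp only [Finset.mul_sum (Finset.univ : Finset (Fin B × Fin L))]
  rw [Finset.sum_comm]
  simp only [Finset.mul_sum (Finset.univ.erase _)]
  have : ∀ j : Fin B × Fin L, ∑ C : Fin B × Fin L → U, ∑ l ∈ Finset.univ.erase j.2,
      (∏ j, π (C j)) * (g (C j) * h (C (j.1, l))) =
        (L - 1 : ℕ) * ((∑ u, π u * g u) * ∑ u, π u * h u) := by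
    intro j
    rw [Finset.sum_comm, Finset.sum_congr rfl fun l hl => codebook_sum_two hπ g h
      (j := j) (k := (j.1, l)) fun h0 => (Finset.mem_erase.1 hl).1 (congrArg Prod.snd h0).symm]
    simp
  rw [Finset.sum_congr rfl fun j _ => this j]
  simp

theorem codebook_sum_singles {π : U → ℝ} (hπ : ∑ u, π u = 1) (g : U → ℝ) :
    ∑ C : Fin B × Fin L → U, (∏ j, π (C j)) * ∑ j : Fin B × Fin L, g (C j) =
      (B * L : ℕ) * ∑ u, π u * g u := by
  simp only [Finset.mul_sum (Finset.univ : Finset (Fin B × Fin L))]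
  rw [Finset.sum_comm, Finset.sum_congr rfl fun j _ => codebook_sum_one hπ g j]
  simp

theorem sum_weighted_comm {Ω : Type*} [Fintype Ω] (w : Ω → ℝ) (P : 𝒳 → 𝒴 → ℝ)
    (f : Ω → 𝒳 → 𝒴 → ℝ) :
    ∑ C, w C * ∑ x, ∑ y, P x y * f C x y = ∑ x, ∑ y, P x y * ∑ C, w C * f C x y := by
  simp only [Finset.mul_sum]
  rw [Finset.sum_comm]
  refine Finset.sum_congr rfl fun x _ => ?_
  rw [Finset.sum_comm]
  refine Finset.sum_congr rfl fun y _ => Finset.sum_congr rfl fun C _ => ?_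
  ring

/-- One-shot random coding bound for testing with quantization and binning. -/
theorem exists_code {π : U → ℝ} (hπ : π ∈ stdSimplex ℝ U) {P Q : 𝒳 → 𝒴 → ℝ}
    (hP : ∀ x y, 0 ≤ P x y) (hQ : ∀ x y, 0 ≤ Q x y)
    (T₁ : U → 𝒳 → Prop) (T₂ G : U → 𝒴 → Prop) (hTG : ∀ u y, T₂ u y → ¬ G u y)
    {ε b : ℝ} (hε : 0 < ε) (hb : 0 < b)
    (h : (∑ x, ∑ y, P x y * ((1 - ∑ u, π u * ind (T₁ u x)) ^ (B * L) +
          (B * L : ℕ) * ∑ u, π u * ind (T₁ u x ∧ ¬ T₂ u y) +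
          (B * L : ℕ) * ((L - 1 : ℕ) * ((∑ u, π u * ind (T₁ u x)) * ∑ u, π u * ind (G u y))))) / ε +
        (∑ x, ∑ y, Q x y * ((B * L : ℕ) * ∑ u, π u * ind (T₁ u x ∧ T₂ u y) +
          (B * L : ℕ) * ((L - 1 : ℕ) * ((∑ u, π u * ind (T₁ u x ∧ ¬ G u y)) *
            ∑ u, π u * ind (T₂ u y))))) / b < 1) :
    ∃ (e : 𝒳 → Fin (B + 1)) (g : 𝒴 → Fin (B + 1) → Fin 2),
      ∑ x, ∑ y, P x y * ind (g y (e x) = 1) ≤ ε ∧ ∑ x, ∑ y, Q x y * ind (g y (e x) = 0) ≤ b := by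
  choose e g hα hβ using fun C => by
    simpa only [forall_and] using exists_code_of_codebook (B := B) (L := L) T₁ T₂ G hTG C
  -- If every codebook violated one of the two bounds, `α / ε + β / b` would be at least 1 for each,
  -- contradicting the bound on its average.
  by_contra hcon
  push Not at hcon
  set w : (Fin B × Fin L → U) → ℝ := fun C => ∏ j, π (C j) with hw
  have hw0 : ∀ C, 0 ≤ w C := fun C => Finset.prod_nonneg fun j _ => hπ.1 _
  have hbad : ∀ C, 1 ≤ (∑ x, ∑ y, P x y * ind (g C y (e C x) = 1)) / ε +
      (∑ x, ∑ y, Q x y * ind (g C y (e C x) = 0)) / b := by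
    intro C
    have h1 : 0 ≤ (∑ x, ∑ y, P x y * ind (g C y (e C x) = 1)) := Finset.sum_nonneg fun x _ =>
      Finset.sum_nonneg fun y _ => mul_nonneg (hP x y) (ind_nonneg _)
    have h2 : 0 ≤ (∑ x, ∑ y, Q x y * ind (g C y (e C x) = 0)) := Finset.sum_nonneg fun x _ =>
      Finset.sum_nonneg fun y _ => mul_nonneg (hQ x y) (ind_nonneg _)
    rcases le_or_gt (∑ x, ∑ y, P x y * ind (g C y (e C x) = 1)) ε with hle | hlt
    · have := hcon _ _ hle
      have h3 := (one_lt_div hb).2 this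
      have := div_nonneg h1 hε.le
      linarith
    · have h3 := (one_lt_div hε).2 hlt
      have := div_nonneg h2 hb.le
      linarith
  have hEα : ∑ C, w C * ∑ x, ∑ y, P x y * ind (g C y (e C x) = 1) ≤
      ∑ x, ∑ y, P x y * ((1 - ∑ u, π u * ind (T₁ u x)) ^ (B * L) +
          (B * L : ℕ) * ∑ u, π u * ind (T₁ u x ∧ ¬ T₂ u y) +
          (B * L : ℕ) * ((L - 1 : ℕ) *
            ((∑ u, π u * ind (T₁ u x)) * ∑ u, π u * ind (G u y)))) := by
    rw [sum_weighted_comm]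
    refine Finset.sum_le_sum fun x _ => Finset.sum_le_sum fun y _ =>
      mul_le_mul_of_nonneg_left ?_ (hP x y)
    refine (Finset.sum_le_sum fun C _ => mul_le_mul_of_nonneg_left (hα C x y) (hw0 C)).trans_eq ?_
    simp only [mul_add, Finset.sum_add_distrib]
    rw [codebook_sum_none hπ.2 (fun u => T₁ u x),
      codebook_sum_singles hπ.2 (fun u => ind (T₁ u x ∧ ¬ T₂ u y)),
      codebook_sum_pairs hπ.2 (fun u => ind (T₁ u x)) (fun u => ind (G u y))]
    simp
  have hEβ : ∑ C, w C * ∑ x, ∑ y, Q x y * ind (g C y (e C x) = 0) ≤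
      ∑ x, ∑ y, Q x y * ((B * L : ℕ) * ∑ u, π u * ind (T₁ u x ∧ T₂ u y) +
          (B * L : ℕ) * ((L - 1 : ℕ) * ((∑ u, π u * ind (T₁ u x ∧ ¬ G u y)) *
            ∑ u, π u * ind (T₂ u y)))) := by
    rw [sum_weighted_comm]
    refine Finset.sum_le_sum fun x _ => Finset.sum_le_sum fun y _ =>
      mul_le_mul_of_nonneg_left ?_ (hQ x y)
    refine (Finset.sum_le_sum fun C _ => mul_le_mul_of_nonneg_left (hβ C x y) (hw0 C)).trans_eq ?_
    simp only [mul_add, Finset.sum_add_distrib]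
    rw [codebook_sum_singles hπ.2 (fun u => ind (T₁ u x ∧ T₂ u y)),
      codebook_sum_pairs hπ.2 (fun u => ind (T₁ u x ∧ ¬ G u y)) (fun u => ind (T₂ u y))]
  have h1 : (1 : ℝ) ≤ ∑ C, w C * ((∑ x, ∑ y, P x y * ind (g C y (e C x) = 1)) / ε +
      (∑ x, ∑ y, Q x y * ind (g C y (e C x) = 0)) / b) := by
    rw [← codebook_sum (J := Fin B × Fin L) hπ.2]
    exact Finset.sum_le_sum fun C _ => le_mul_of_one_le_right (hw0 C) (hbad C)
  simp only [mul_add, Finset.sum_add_distrib, ← mul_div_assoc, ← Finset.sum_div] at h1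
  have h2 := div_le_div_of_nonneg_right hEα hε.le
  have h3 := div_le_div_of_nonneg_right hEβ hb.le
  linarith

end RandomCoding

/-! ### Change of measure between codewords and channel outputs -/

section ChangeOfMeasure

variable {A S X Y Z : Type*} [Fintype A] [Fintype S] [Fintype X] [Fintype Y] [Fintype Z]

/-- The mean of the log-likelihood ratio of the channel `V` to the pmf `π` under `q`. -/
def meanLLR (V : Z → S → ℝ) (π : S → ℝ) (q : S × Z → ℝ) : ℝ :=
  ∑ a, q a * Real.logb 2 (V a.2 a.1 / π a.1)

theorem continuous_meanLLR (V : Z → S → ℝ) (π : S → ℝ) : Continuous (meanLLR V π) :=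
  continuous_finsetSum _ fun a _ => (continuous_apply a).mul continuous_const

theorem mutualInfo_channel {V : Z → S → ℝ} {π : S → ℝ} {m : Z → ℝ} (hV : ∀ z s, 0 < V z s)
    (hVs : ∀ z, ∑ s, V z s = 1) (hm : ∀ z, 0 ≤ m z)
    (hπ : margFst (fun a : S × Z => V a.2 a.1 * m a.2) = π) :
    mutualInfo (fun a : S × Z => V a.2 a.1 * m a.2) =
      meanLLR V π fun a => V a.2 a.1 * m a.2 := by
  have h2 : margSnd (fun a : S × Z => V a.2 a.1 * m a.2) = m := by
    funext z
    simp only [margSnd, ← Finset.sum_mul, hVs, one_mul]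
  rw [mutualInfo_eq fun a => mul_nonneg (hV _ _).le (hm _), hπ, h2, meanLLR]
  refine Finset.sum_congr rfl fun a _ => ?_
  by_cases h : m a.2 = 0
  · simp [h]
  · rw [mul_div_mul_right _ _ h]

/-- The likelihood ratio of `V^n` to `π^n` is a product over positions, so it depends on the pair of
sequences only through their joint type. -/
theorem prod_eq_rpow_mul_prod {V : Z → S → ℝ} {π : S → ℝ} (hV : ∀ z s, 0 < V z s)
    (hπ : ∀ s, 0 < π s) {n : ℕ} (s : Fin n → S) (z : Fin n → Z) :
    ∏ i, V (z i) (s i) =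
      2 ^ ((n : ℝ) * meanLLR V π (empirical fun i => (s i, z i))) * prodProb π s := by
  have h := prodProb_eq_rpow (r := fun a : S × Z => V a.2 a.1 / π a.1)
    (z := fun i => (s i, z i)) fun i => div_pos (hV _ _) (hπ _)
  rw [meanLLR, ← h, prodProb, prodProb, ← Finset.prod_mul_distrib]
  exact Finset.prod_congr rfl fun i _ => (div_mul_cancel₀ _ (hπ _).ne').symm

theorem prodProb_le_channel {V : Z → S → ℝ} {π : S → ℝ} (hV : ∀ z s, 0 < V z s)
    (hπ : ∀ s, 0 < π s) {n : ℕ} {s : Fin n → S} {z : Fin n → Z} {i : ℝ}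
    (h : i ≤ meanLLR V π (empirical fun i => (s i, z i))) :
    prodProb π s ≤ 2 ^ (-((n : ℝ) * i)) * ∏ i, V (z i) (s i) := by
  rw [prod_eq_rpow_mul_prod hV hπ, ← mul_assoc, ← Real.rpow_add two_pos]
  refine le_mul_of_one_le_left (prodProb_nonneg (fun s => (hπ s).le) s)
    (Real.one_le_rpow (by norm_num) ?_)
  have := mul_le_mul_of_nonneg_left h (Nat.cast_nonneg (α := ℝ) n)
  linarith

theorem channel_le_prodProb {V : Z → S → ℝ} {π : S → ℝ} (hV : ∀ z s, 0 < V z s)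
    (hπ : ∀ s, 0 < π s) {n : ℕ} {s : Fin n → S} {z : Fin n → Z} {i : ℝ}
    (h : meanLLR V π (empirical fun i => (s i, z i)) ≤ i) :
    2 ^ (-((n : ℝ) * i)) * ∏ i, V (z i) (s i) ≤ prodProb π s := by
  rw [prod_eq_rpow_mul_prod hV hπ, ← mul_assoc, ← Real.rpow_add two_pos]
  refine mul_le_of_le_one_left (prodProb_nonneg (fun s => (hπ s).le) s)
    (Real.rpow_le_one_of_one_le_of_nonpos (by norm_num) ?_)
  have := mul_le_mul_of_nonneg_left h (Nat.cast_nonneg (α := ℝ) n)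
  linarith

theorem sum_channel {V : Z → S → ℝ} (hVs : ∀ z, ∑ s, V z s = 1) {n : ℕ} (z : Fin n → Z) :
    ∑ s : Fin n → S, ∏ i, V (z i) (s i) = 1 := by
  classical
  have e := (Finset.prod_univ_sum (fun _ : Fin n => (Finset.univ : Finset S))
    (fun i s => V (z i) s)).symm
  simp only [Fintype.piFinset_univ] at e
  rw [e]
  exact Finset.prod_eq_one fun i _ => hVs _

/-- The probability that an independent codeword is typical with a given sequence. -/
theorem sum_prodProb_ind_le {V : Z → S → ℝ} {π : S → ℝ} (hV : ∀ z s, 0 < V z s)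
    (hVs : ∀ z, ∑ s, V z s = 1) (hπ : ∀ s, 0 < π s) {n : ℕ} {z : Fin n → Z}
    {T : (Fin n → S) → Prop} {i : ℝ}
    (hT : ∀ s, T s → i ≤ meanLLR V π (empirical fun i => (s i, z i))) :
    ∑ s, prodProb π s * ind (T s) ≤ 2 ^ (-((n : ℝ) * i)) := by
  calc _ ≤ ∑ s : Fin n → S, 2 ^ (-((n : ℝ) * i)) * ∏ i, V (z i) (s i) := by
        refine Finset.sum_le_sum fun s _ => ?_
        by_cases h : T s
        · rw [ind_of h, mul_one]
          exact prodProb_le_channel hV hπ (hT s h)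
        · rw [ind_of_not h, mul_zero]
          exact mul_nonneg (by positivity) (Finset.prod_nonneg fun i _ => (hV _ _).le)
    _ = _ := by rw [← Finset.mul_sum, sum_channel hVs, mul_one]

theorem sum_seq_prod {A B : Type*} [Fintype A] [Fintype B] {n : ℕ} (g : (Fin n → A × B) → ℝ) :
    ∑ z, g z = ∑ u : Fin n → A, ∑ v : Fin n → B, g fun i => (u i, v i) := by
  rw [← (Equiv.arrowProdEquivProdArrow (Fin n) (fun _ => A) (fun _ => B)).symm.sum_comp,
    Fintype.sum_prod_type]
  rfl

/-- Sanov's bound for the triple `(S, X, Y)`. -/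
theorem sanov_joint {W : X → S → ℝ} (hW : ∀ x s, 0 ≤ W x s) {P : X × Y → ℝ}
    (hP : ∀ a, 0 ≤ P a) {n : ℕ} (hn : 0 < n)
    {F : (Fin n → S) → (Fin n → X) → (Fin n → Y) → Prop} {d : ℝ}
    (hF : ∀ s x y, F s x y →
      (d : EReal) ≤ klDivergence (empirical fun i => (s i, x i, y i)) (joint W P)) :
    ∑ x : Fin n → X, ∑ y : Fin n → Y, (∏ i, P (x i, y i)) *
        ∑ s : Fin n → S, (∏ i, W (x i) (s i)) * ind (F s x y) ≤
      ((n : ℝ) + 1) ^ Fintype.card (S × X × Y) * 2 ^ (-((n : ℝ) * d)) := by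
  classical
  let E : (Fin n → S × X × Y) → Prop := fun z =>
    F (fun i => (z i).1) (fun i => (z i).2.1) fun i => (z i).2.2
  refine le_trans (le_of_eq ?_) (sanov_upper (joint_nonneg hP hW) hn E fun z hz => hF _ _ _ hz)
  symm
  rw [sum_seq_prod]
  simp only [sum_seq_prod (A := X) (B := Y)]
  rw [Finset.sum_comm]
  refine Finset.sum_congr rfl fun x _ => ?_
  rw [Finset.sum_comm]
  refine Finset.sum_congr rfl fun y _ => ?_
  rw [Finset.mul_sum]
  refine Finset.sum_congr rfl fun s _ => ?_
  have e : prodProb (joint W P) (fun i => (s i, x i, y i)) =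
      (∏ i, W (x i) (s i)) * ∏ i, P (x i, y i) := Finset.prod_mul_distrib
  rw [e, ind, mul_ite, mul_ite, mul_one, mul_zero, mul_zero, mul_comm (∏ i, P _)]

/-- Change of measure from the codeword distribution to the channel. -/
theorem sum_change_of_measure {W : X → S → ℝ} {π : S → ℝ} (hW : ∀ x s, 0 < W x s)
    (hπ : ∀ s, 0 < π s) {P : X × Y → ℝ} (hP : ∀ a, 0 ≤ P a) {n : ℕ}
    {F : (Fin n → S) → (Fin n → X) → (Fin n → Y) → Prop} {i : ℝ}
    (hF : ∀ s x y, F s x y → i ≤ meanLLR W π (empirical fun i => (s i, x i))) :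
    ∑ x : Fin n → X, ∑ y : Fin n → Y, (∏ i, P (x i, y i)) *
        ∑ s : Fin n → S, prodProb π s * ind (F s x y) ≤
      2 ^ (-((n : ℝ) * i)) * ∑ x : Fin n → X, ∑ y : Fin n → Y, (∏ i, P (x i, y i)) *
        ∑ s : Fin n → S, (∏ i, W (x i) (s i)) * ind (F s x y) := by
  simp only [Finset.mul_sum]
  refine Finset.sum_le_sum fun x _ => Finset.sum_le_sum fun y _ => Finset.sum_le_sum fun s _ => ?_
  have hp : 0 ≤ ∏ i, P (x i, y i) := Finset.prod_nonneg fun i _ => hP _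
  by_cases h : F s x y
  · rw [ind_of h, mul_one, mul_one, mul_left_comm]
    exact mul_le_mul_of_nonneg_left (prodProb_le_channel hW hπ (hF s x y h)) hp
  · simp [ind_of_not h]

/-- The power is at most `exp (-(u * w))`. If `w ≤ 1/2` then `2 * (1 - w) ≥ 1`; otherwise `exp (-(u
* w)) ≤ 1 / (u * w) ≤ 2 / u`. A bound affine in `w` can be averaged over `x`. -/
theorem one_sub_pow_le {t u w : ℝ} {N : ℕ} (ht : t ≤ 1) (hu : 0 < u) (hw : 0 ≤ w) (hw' : w ≤ 1)
    (h : u * w ≤ N * t) : (1 - t) ^ N ≤ 2 * (1 - w) + 2 / u := by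
  have h1 : (1 - t) ^ N ≤ Real.exp (-(u * w)) := by
    calc (1 - t) ^ N ≤ Real.exp (-t) ^ N := by
          refine pow_le_pow_left₀ (by linarith) ?_ N
          linarith [Real.add_one_le_exp (-t)]
      _ = Real.exp (-(N * t)) := by rw [← Real.exp_nat_mul]; ring_nf
      _ ≤ _ := Real.exp_le_exp.2 (by linarith)
  refine h1.trans ?_
  have hu2 : 0 < 2 / u := by positivity
  rcases le_or_gt w (1 / 2) with hw2 | hw2
  · have : Real.exp (-(u * w)) ≤ 1 := Real.exp_le_one_iff.2 (by nlinarith)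
    linarith
  · have hw0 : 0 < w := by linarith
    have h2 : Real.exp (-(u * w)) ≤ 1 / (u * w) := by
      rw [Real.exp_neg, ← one_div]
      exact one_div_le_one_div_of_le (by positivity) (by linarith [Real.add_one_le_exp (u * w)])
    have h3 : 1 / (u * w) ≤ 2 / u := by
      rw [div_le_div_iff₀ (by positivity) hu]
      nlinarith
    linarith

/-- The covering lemma. -/
theorem sum_not_covered_le {W : X → S → ℝ} {π : S → ℝ} (hW : ∀ x s, 0 < W x s)
    (hWs : ∀ x, ∑ s, W x s = 1)
    (hπ : ∀ s, 0 < π s) (hπs : ∑ s, π s = 1) {P : X × Y → ℝ} (hP : P ∈ stdSimplex ℝ (X × Y))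
    {n : ℕ} {T : (Fin n → S) → (Fin n → X) → Prop} {i u : ℝ} {N : ℕ} (hu : 0 < u)
    (hN : u ≤ N * 2 ^ (-((n : ℝ) * i)))
    (hT : ∀ s x, T s x → meanLLR W π (empirical fun i => (s i, x i)) ≤ i) :
    ∑ x : Fin n → X, ∑ y : Fin n → Y, (∏ i, P (x i, y i)) *
        (1 - ∑ s, prodProb π s * ind (T s x)) ^ N ≤
      2 * ∑ x : Fin n → X, ∑ y : Fin n → Y, (∏ i, P (x i, y i)) *
        ∑ s : Fin n → S, (∏ i, W (x i) (s i)) * ind (¬ T s x) + 2 / u := by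
  have hPs : ∑ x : Fin n → X, ∑ y : Fin n → Y, ∏ i, P (x i, y i) = 1 := by
    have h := sum_prodProb P n
    rw [hP.2, one_pow, sum_seq_prod] at h
    exact h
  have hw : ∀ x : Fin n → X, ∑ s : Fin n → S, (∏ i, W (x i) (s i)) * ind (T s x) =
      1 - ∑ s : Fin n → S, (∏ i, W (x i) (s i)) * ind (¬ T s x) := by
    intro x
    rw [← sum_channel hWs x, ← Finset.sum_sub_distrib]
    refine Finset.sum_congr rfl fun s _ => ?_
    by_cases h : T s x <;> simp [ind, h]
  have hn0 : ∀ (x : Fin n → X) (T : (Fin n → S) → Prop),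
      0 ≤ ∑ s : Fin n → S, (∏ i, W (x i) (s i)) * ind (T s) := fun x T =>
    Finset.sum_nonneg fun s _ =>
      mul_nonneg (Finset.prod_nonneg fun i _ => (hW _ _).le) (ind_nonneg _)
  -- Here `w` is the channel probability of typicality with `x`. On typical sequences `π^n` is at
  -- least `2^{-ni}` times the channel law, which gives `u * w ≤ N * t`.
  have key : ∀ x : Fin n → X, (1 - ∑ s, prodProb π s * ind (T s x)) ^ N ≤
      2 * (∑ s : Fin n → S, (∏ i, W (x i) (s i)) * ind (¬ T s x)) + 2 / u := by
    intro x
    have h := one_sub_pow_le (t := ∑ s, prodProb π s * ind (T s x)) (u := u)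
      (w := ∑ s : Fin n → S, (∏ i, W (x i) (s i)) * ind (T s x)) (N := N) ?_ hu (hn0 x _) ?_ ?_
    · rw [hw x] at h
      linarith
    · calc _ ≤ ∑ s : Fin n → S, prodProb π s := Finset.sum_le_sum fun s _ =>
            mul_le_of_le_one_right (prodProb_nonneg (fun s => (hπ s).le) s) (ind_le_one _)
        _ = 1 := by rw [sum_prodProb, hπs, one_pow]
    · rw [hw x]
      linarith [hn0 x fun s => ¬ T s x]
    · calc _ ≤ N * 2 ^ (-((n : ℝ) * i)) *
              ∑ s : Fin n → S, (∏ i, W (x i) (s i)) * ind (T s x) :=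
            mul_le_mul_of_nonneg_right hN (hn0 x _)
        _ ≤ _ := by
            rw [mul_assoc, Finset.mul_sum]
            refine mul_le_mul_of_nonneg_left (Finset.sum_le_sum fun s _ => ?_) (Nat.cast_nonneg _)
            rw [← mul_assoc]
            by_cases h : T s x
            · rw [ind_of h, mul_one, mul_one]
              exact channel_le_prodProb hW hπ (hT s x h)
            · simp [ind_of_not h]
  calc _ ≤ ∑ x : Fin n → X, ∑ y : Fin n → Y, (∏ i, P (x i, y i)) *
        (2 * (∑ s : Fin n → S, (∏ i, W (x i) (s i)) * ind (¬ T s x)) + 2 / u) :=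
        Finset.sum_le_sum fun x _ => Finset.sum_le_sum fun y _ =>
          mul_le_mul_of_nonneg_left (key x) (Finset.prod_nonneg fun i _ => hP.1 _)
    _ = _ := by
        simp only [mul_add, Finset.sum_add_distrib, ← Finset.sum_mul, hPs, one_mul]
        congr 1
        rw [Finset.mul_sum]
        refine Finset.sum_congr rfl fun x _ => ?_
        ring

/-- The probability that an independent codeword has small conditional entropy given `y`. -/
theorem sum_prodProb_low_le {π : S → ℝ} (hπ : ∀ s, 0 < π s) {n : ℕ} (y : Fin n → Y) (k h : ℝ) :
    ∑ s, prodProb π s * ind (∑ a, empirical s a * Real.logb 2 (π a) ≤ -k ∧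
        condEntropy (empirical fun i => (s i, y i)) ≤ h) ≤
      ((n : ℝ) + 1) ^ Fintype.card (S × Y) * 2 ^ (-((n : ℝ) * (k - h))) := by
  classical
  -- The first constraint says exactly that `s` has probability at most `2^{-nk}`; the second is
  -- then handled by counting.
  calc _ ≤ ∑ s : Fin n → S, 2 ^ (-((n : ℝ) * k)) *
        (if condEntropy (empirical fun i => (s i, y i)) ≤ h then (1 : ℝ) else 0) := by
        refine Finset.sum_le_sum fun s _ => ?_
        by_cases h1 : ∑ a, empirical s a * Real.logb 2 (π a) ≤ -k
        · rw [ind_and, ind_of h1, one_mul, prodProb_eq_rpow fun i => hπ _, ind]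
          gcongr
          · norm_num
          · have := mul_le_mul_of_nonneg_left h1 (Nat.cast_nonneg (α := ℝ) n)
            linarith
        · rw [ind_and, ind_of_not h1]
          simp only [zero_mul, mul_zero]
          positivity
    _ ≤ 2 ^ (-((n : ℝ) * k)) *
          (((n : ℝ) + 1) ^ Fintype.card (S × Y) * 2 ^ ((n : ℝ) * h)) := by
        rw [← Finset.mul_sum]
        exact mul_le_mul_of_nonneg_left (card_condEntropy_le y h) (by positivity)
    _ = _ := by
        rw [mul_left_comm, ← Real.rpow_add two_pos]
        congr 2
        ring

end ChangeOfMeasure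

/-! ### Error bounds at a fixed blocklength -/

section Scheme

variable {S X Y : Type*} [Fintype S] [Fintype X] [Fintype Y]

theorem exists_scheme_of_code {n B : ℕ} {R : ℝ} (hB : B ≤ ⌊(2 : ℝ) ^ ((n : ℝ) * R)⌋₊)
    (e : (Fin n → X) → Fin (B + 1)) (g : (Fin n → Y) → Fin (B + 1) → Fin 2) :
    ∃ c : Scheme X Y R n, ∀ (P : X × Y → ℝ) (h : Fin 2), guessProb P c h =
      ∑ x : Fin n → X, ∑ y : Fin n → Y, (∏ i, P (x i, y i)) * ind (g y (e x) = h) := by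
  refine ⟨⟨fun x m => if m = Fin.castLE (Nat.succ_le_succ hB) (e x) then 1 else 0,
    fun x => ⟨fun m => by positivity, by simp⟩,
    -- Messages beyond `B` are never sent; the guess 1 there is arbitrary.
    fun y m => if hm : m.1 < B + 1 then g y ⟨m.1, hm⟩ else 1⟩, fun P h => ?_⟩
  refine Finset.sum_congr rfl fun x _ => Finset.sum_congr rfl fun y _ => ?_
  congr 1
  rw [Finset.sum_eq_single (Fin.castLE (Nat.succ_le_succ hB) (e x))]
  · simp [ind, Nat.lt_succ_iff.1 (e x).isLt]
  · intro m _ hm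
    simp [hm]
  · simp

/-- The error bounds of the quantize-and-bin scheme at a fixed blocklength. -/
theorem exists_scheme {W : X → S → ℝ} {V : Y → S → ℝ} {π : S → ℝ} {P Q : X × Y → ℝ}
    (hW : ∀ x s, 0 < W x s) (hWs : ∀ x, ∑ s, W x s = 1)
    (hV : ∀ y s, 0 < V y s) (hVs : ∀ y, ∑ s, V y s = 1)
    (hπ : ∀ s, 0 < π s) (hπs : ∑ s, π s = 1)
    (hP : P ∈ stdSimplex ℝ (X × Y)) (hQ : Q ∈ stdSimplex ℝ (X × Y))
    {N₁ : Set (S × X → ℝ)} {N₂ : Set (S × Y → ℝ)} {N₃ : Set (Y → ℝ)}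
    {i i' j k h c₁ c₂ d₁ d₂ : ℝ}
    (hi : ∀ q ∈ N₁, i ≤ meanLLR W π q) (hi' : ∀ q ∈ N₁, meanLLR W π q ≤ i')
    (hk : ∀ q ∈ N₁, ∑ a, margFst q a * Real.logb 2 (π a) ≤ -k)
    (hj : ∀ q ∈ N₂, j ≤ meanLLR V π q) (hh : ∀ q ∈ N₂, h < condEntropy q)
    (hN₃ : ∀ q ∈ N₂, margSnd q ∈ N₃)
    (hc₁ : ∀ p ∈ stdSimplex ℝ (S × X × Y), margSX p ∉ N₁ →
      (c₁ : EReal) ≤ klDivergence p (joint W P))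
    (hc₂ : ∀ p ∈ stdSimplex ℝ (S × X × Y), margSY p ∉ N₂ →
      (c₂ : EReal) ≤ klDivergence p (joint W P))
    (hd₁ : ∀ p ∈ stdSimplex ℝ (S × X × Y), margSX p ∈ N₁ → margSY p ∈ N₂ →
      (d₁ : EReal) ≤ klDivergence p (joint W Q))
    (hd₂ : ∀ p ∈ stdSimplex ℝ (S × X × Y), margSX p ∈ N₁ → margY p ∈ N₃ →
      h < condEntropy (margSY p) → (d₂ : EReal) ≤ klDivergence p (joint W Q))
    {n B L : ℕ} (hn : 0 < n) {R : ℝ} (hB : B ≤ ⌊(2 : ℝ) ^ ((n : ℝ) * R)⌋₊)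
    {u M ε b : ℝ} (hu : 0 < u) (hε : 0 < ε) (hb : 0 < b)
    (hul : u ≤ (B * L : ℕ) * 2 ^ (-((n : ℝ) * i')))
    (hM : (B * L : ℕ) * 2 ^ (-((n : ℝ) * i)) ≤ M)
    (hfin : (2 * (((n : ℝ) + 1) ^ Fintype.card (S × X × Y) * 2 ^ (-((n : ℝ) * c₁))) + 2 / u +
          M * (((n : ℝ) + 1) ^ Fintype.card (S × X × Y) * 2 ^ (-((n : ℝ) * c₂))) +
          M * ((L - 1 : ℕ) * (((n : ℝ) + 1) ^ Fintype.card (S × Y) *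
            2 ^ (-((n : ℝ) * (k - h)))))) / ε +
        (M * (((n : ℝ) + 1) ^ Fintype.card (S × X × Y) * 2 ^ (-((n : ℝ) * d₁))) +
          M * ((L - 1 : ℕ) * (2 ^ (-((n : ℝ) * j)) *
            (((n : ℝ) + 1) ^ Fintype.card (S × X × Y) * 2 ^ (-((n : ℝ) * d₂)))))) / b < 1) :
    ∃ c : Scheme X Y R n, guessProb P c 1 ≤ ε ∧ guessProb Q c 0 ≤ b := by
  set T₁ : (Fin n → S) → (Fin n → X) → Prop := fun s x => (empirical fun i => (s i, x i)) ∈ N₁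
    with hT₁
  set T₂ : (Fin n → S) → (Fin n → Y) → Prop := fun s y => (empirical fun i => (s i, y i)) ∈ N₂
    with hT₂
  -- The first condition caps the probability of `s`, making `G` rare. It holds for every codeword
  -- satisfying `T₁`, so for those `¬ G` means high conditional entropy.
  set G : (Fin n → S) → (Fin n → Y) → Prop := fun s y =>
    ∑ a, empirical s a * Real.logb 2 (π a) ≤ -k ∧ condEntropy (empirical fun i => (s i, y i)) ≤ h
    with hG
  have hTG : ∀ s y, T₂ s y → ¬ G s y := fun s y h2 hg => (hh _ h2).not_ge hg.2
  have hPn : ∀ (x : Fin n → X) (y : Fin n → Y), 0 ≤ ∏ i, P (x i, y i) := fun x y =>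
    Finset.prod_nonneg fun i _ => hP.1 _
  have hQn : ∀ (x : Fin n → X) (y : Fin n → Y), 0 ≤ ∏ i, Q (x i, y i) := fun x y =>
    Finset.prod_nonneg fun i _ => hQ.1 _
  have hπn : prodProb π ∈ stdSimplex ℝ (Fin n → S) :=
    ⟨prodProb_nonneg fun s => (hπ s).le, by rw [sum_prodProb, hπs, one_pow]⟩
  have hπ0 : ∀ T : (Fin n → S) → Prop, 0 ≤ ∑ s, prodProb π s * ind (T s) := fun T =>
    Finset.sum_nonneg fun s _ => mul_nonneg (hπn.1 s) (ind_nonneg _)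
  have hW0 : ∀ x s, 0 ≤ W x s := fun x s => (hW x s).le
  have hN0 : (0 : ℝ) ≤ (B * L : ℕ) := Nat.cast_nonneg _
  have hL0 : (0 : ℝ) ≤ (L - 1 : ℕ) := Nat.cast_nonneg _
  set K : ℝ := ((n : ℝ) + 1) ^ Fintype.card (S × X × Y) with hK
  set K' : ℝ := ((n : ℝ) + 1) ^ Fintype.card (S × Y) with hK'
  have hK0 : 0 ≤ K := by positivity
  have hK0' : 0 ≤ K' := by positivity
  -- covering
  have b1 : ∑ x : Fin n → X, ∑ y : Fin n → Y, (∏ i, P (x i, y i)) *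
      (1 - ∑ s, prodProb π s * ind (T₁ s x)) ^ (B * L) ≤
        2 * (K * 2 ^ (-((n : ℝ) * c₁))) + 2 / u := by
    refine (sum_not_covered_le hW hWs hπ hπs hP hu hul (T := T₁)
      fun s x hs => hi' _ hs).trans ?_
    gcongr
    refine sanov_joint hW0 hP.1 hn (F := fun s x _ => ¬ T₁ s x) fun s x y hs => ?_
    refine hc₁ _ (empirical_mem hn _) ?_
    rwa [margSX_empirical]
  -- change of measure for the chosen codeword
  have cm : ∀ (P' : X × Y → ℝ), (∀ a, 0 ≤ P' a) → ∀ (d : ℝ)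
      (F : (Fin n → S) → (Fin n → X) → (Fin n → Y) → Prop), (∀ s x y, F s x y → T₁ s x) →
      (∀ s x y, F s x y →
        (d : EReal) ≤ klDivergence (empirical fun i => (s i, x i, y i)) (joint W P')) →
      (B * L : ℕ) * ∑ x : Fin n → X, ∑ y : Fin n → Y, (∏ i, P' (x i, y i)) *
        ∑ s : Fin n → S, prodProb π s * ind (F s x y) ≤ M * (K * 2 ^ (-((n : ℝ) * d))) := by
    intro P' hP' d F hF1 hF2
    calc _ ≤ ((B * L : ℕ) : ℝ) * (2 ^ (-((n : ℝ) * i)) * (K * 2 ^ (-((n : ℝ) * d)))) := by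
          refine mul_le_mul_of_nonneg_left ?_ hN0
          refine (sum_change_of_measure hW hπ hP' fun s x y hs => hi _ (hF1 s x y hs)).trans ?_
          exact mul_le_mul_of_nonneg_left (sanov_joint hW0 hP' hn hF2) (by positivity)
      _ ≤ _ := by
          rw [← mul_assoc]
          exact mul_le_mul_of_nonneg_right hM (by positivity)
  have b2 : (B * L : ℕ) * ∑ x : Fin n → X, ∑ y : Fin n → Y, (∏ i, P (x i, y i)) *
      ∑ s : Fin n → S, prodProb π s * ind (T₁ s x ∧ ¬ T₂ s y) ≤
        M * (K * 2 ^ (-((n : ℝ) * c₂))) := by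
    refine cm P hP.1 c₂ (fun s x y => T₁ s x ∧ ¬ T₂ s y) (fun s x y hs => hs.1) fun s x y hs => ?_
    refine hc₂ _ (empirical_mem hn _) ?_
    rw [margSY_empirical]
    exact hs.2
  have b4 : (B * L : ℕ) * ∑ x : Fin n → X, ∑ y : Fin n → Y, (∏ i, Q (x i, y i)) *
      ∑ s : Fin n → S, prodProb π s * ind (T₁ s x ∧ T₂ s y) ≤
        M * (K * 2 ^ (-((n : ℝ) * d₁))) := by
    refine cm Q hQ.1 d₁ (fun s x y => T₁ s x ∧ T₂ s y) (fun s x y hs => hs.1) fun s x y hs => ?_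
    refine hd₁ _ (empirical_mem hn _) ?_ ?_
    · rw [margSX_empirical]
      exact hs.1
    · rw [margSY_empirical]
      exact hs.2
  -- The condition on the type of `y` is what survives of the competitor's typicality after
  -- averaging over the competitor; it supplies the `Y`-marginal constraint of the second exponent.
  have b5' : (B * L : ℕ) * ∑ x : Fin n → X, ∑ y : Fin n → Y, (∏ i, Q (x i, y i)) *
      ∑ s : Fin n → S, prodProb π s * ind ((T₁ s x ∧ ¬ G s y) ∧ empirical y ∈ N₃) ≤
        M * (K * 2 ^ (-((n : ℝ) * d₂))) := by
    refine cm Q hQ.1 d₂ (fun s x y => (T₁ s x ∧ ¬ G s y) ∧ empirical y ∈ N₃)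
      (fun s x y hs => hs.1.1) fun s x y hs => ?_
    refine hd₂ _ (empirical_mem hn _) ?_ ?_ ?_
    · rw [margSX_empirical]
      exact hs.1.1
    · rw [margY_empirical]
      exact hs.2
    · rw [margSY_empirical]
      by_contra hlow
      refine hs.1.2 ⟨?_, not_lt.1 hlow⟩
      have := hk _ hs.1.1
      rwa [margFst_empirical] at this
  have b3 : ∑ x : Fin n → X, ∑ y : Fin n → Y, (∏ i, P (x i, y i)) * ((B * L : ℕ) *
      ((L - 1 : ℕ) * ((∑ s, prodProb π s * ind (T₁ s x)) * ∑ s, prodProb π s * ind (G s y)))) ≤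
        M * ((L - 1 : ℕ) * (K' * 2 ^ (-((n : ℝ) * (k - h))))) := by
    have hPs : ∑ x : Fin n → X, ∑ y : Fin n → Y, ∏ i, P (x i, y i) = 1 := by
      have h := sum_prodProb P n
      rw [hP.2, one_pow, sum_seq_prod] at h
      exact h
    rw [← one_mul (M * _), ← hPs, Finset.sum_mul]
    refine Finset.sum_le_sum fun x _ => ?_
    rw [Finset.sum_mul]
    refine Finset.sum_le_sum fun y _ => mul_le_mul_of_nonneg_left ?_ (hPn x y)
    have e1 := sum_prodProb_ind_le hW hWs hπ (z := x) (T := fun s => T₁ s x) fun s hs => hi _ hs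
    have e2 := sum_prodProb_low_le hπ y k h
    calc _ ≤ ((B * L : ℕ) : ℝ) * ((L - 1 : ℕ) * (2 ^ (-((n : ℝ) * i)) *
          (K' * 2 ^ (-((n : ℝ) * (k - h)))))) := by
          refine mul_le_mul_of_nonneg_left (mul_le_mul_of_nonneg_left ?_ hL0) hN0
          exact mul_le_mul e1 e2 (hπ0 _) (by positivity)
      _ = ((B * L : ℕ) * 2 ^ (-((n : ℝ) * i))) * ((L - 1 : ℕ) *
          (K' * 2 ^ (-((n : ℝ) * (k - h))))) := by ring
      _ ≤ _ := mul_le_mul_of_nonneg_right hM (by positivity)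
  have b5 : ∑ x : Fin n → X, ∑ y : Fin n → Y, (∏ i, Q (x i, y i)) * ((B * L : ℕ) *
      ((L - 1 : ℕ) * ((∑ s, prodProb π s * ind (T₁ s x ∧ ¬ G s y)) *
        ∑ s, prodProb π s * ind (T₂ s y)))) ≤
        M * ((L - 1 : ℕ) * (2 ^ (-((n : ℝ) * j)) * (K * 2 ^ (-((n : ℝ) * d₂))))) := by
    -- An independent competitor is typical with `y` with probability at most `2^{-nj}`, and only if
    -- the type of `y` lies in `N₃`.
    have e : ∀ (x : Fin n → X) (y : Fin n → Y),
        (∑ s, prodProb π s * ind (T₁ s x ∧ ¬ G s y)) * ∑ s, prodProb π s * ind (T₂ s y) ≤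
          2 ^ (-((n : ℝ) * j)) *
            ∑ s, prodProb π s * ind ((T₁ s x ∧ ¬ G s y) ∧ empirical y ∈ N₃) := by
      intro x y
      by_cases hy : empirical y ∈ N₃
      · simp only [hy, and_true]
        rw [mul_comm]
        refine mul_le_mul_of_nonneg_right ?_ (hπ0 _)
        exact sum_prodProb_ind_le hV hVs hπ fun s hs => hj _ hs
      · have : ∑ s, prodProb π s * ind (T₂ s y) = 0 := by
          refine Finset.sum_eq_zero fun s _ => ?_
          rw [ind_of_not, mul_zero]
          intro hs
          have := hN₃ _ hs
          rw [margSnd_empirical] at this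
          exact hy this
        rw [this, mul_zero]
        exact mul_nonneg (by positivity) (hπ0 _)
    calc _ ≤ ∑ x : Fin n → X, ∑ y : Fin n → Y, (∏ i, Q (x i, y i)) * ((B * L : ℕ) *
        ((L - 1 : ℕ) * (2 ^ (-((n : ℝ) * j)) *
            ∑ s, prodProb π s * ind ((T₁ s x ∧ ¬ G s y) ∧ empirical y ∈ N₃)))) := by
          refine Finset.sum_le_sum fun x _ => Finset.sum_le_sum fun y _ =>
            mul_le_mul_of_nonneg_left ?_ (hQn x y)
          exact mul_le_mul_of_nonneg_left (mul_le_mul_of_nonneg_left (e x y) hL0) hN0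
      _ = ((L - 1 : ℕ) * 2 ^ (-((n : ℝ) * j))) * ((B * L : ℕ) *
            ∑ x : Fin n → X, ∑ y : Fin n → Y, (∏ i, Q (x i, y i)) *
              ∑ s, prodProb π s * ind ((T₁ s x ∧ ¬ G s y) ∧ empirical y ∈ N₃)) := by
          simp only [Finset.mul_sum (Finset.univ : Finset (Fin n → X)),
            Finset.mul_sum (Finset.univ : Finset (Fin n → Y))]
          refine Finset.sum_congr rfl fun x _ => Finset.sum_congr rfl fun y _ => ?_
          ring
      _ ≤ ((L - 1 : ℕ) * 2 ^ (-((n : ℝ) * j))) * (M * (K * 2 ^ (-((n : ℝ) * d₂)))) :=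
          mul_le_mul_of_nonneg_left b5' (by positivity)
      _ = _ := by ring
  have pull : ∀ (P' : X × Y → ℝ) (F : (Fin n → S) → (Fin n → X) → (Fin n → Y) → Prop),
      ∑ x : Fin n → X, ∑ y : Fin n → Y, (∏ i, P' (x i, y i)) * ((B * L : ℕ) *
        ∑ s : Fin n → S, prodProb π s * ind (F s x y)) =
      (B * L : ℕ) * ∑ x : Fin n → X, ∑ y : Fin n → Y, (∏ i, P' (x i, y i)) *
        ∑ s : Fin n → S, prodProb π s * ind (F s x y) := by
    intro P' F
    simp only [Finset.mul_sum (Finset.univ : Finset (Fin n → X)),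
      Finset.mul_sum (Finset.univ : Finset (Fin n → Y))]
    refine Finset.sum_congr rfl fun x _ => Finset.sum_congr rfl fun y _ => ?_
    ring
  obtain ⟨e, g, h1, h2⟩ := exists_code (B := B) (L := L) hπn hPn hQn T₁ T₂ G hTG hε hb (by
    refine lt_of_le_of_lt ?_ hfin
    simp only [mul_add, Finset.sum_add_distrib]
    rw [pull P fun s x y => T₁ s x ∧ ¬ T₂ s y, pull Q fun s x y => T₁ s x ∧ T₂ s y]
    gcongr)
  obtain ⟨c, hc⟩ := exists_scheme_of_code hB e g
  exact ⟨c, by rw [hc]; exact h1, by rw [hc]; exact h2⟩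

end Scheme

/-! ### Choice of rates and tolerances -/

section Asymptotics

open Topology

theorem tendsto_poly_mul_rpow (K : ℕ) {κ : ℝ} (hκ : 0 < κ) :
    Tendsto (fun n : ℕ => ((n : ℝ) + 1) ^ K * (2 : ℝ) ^ (-((n : ℝ) * κ))) atTop (𝓝 0) := by
  have hr0 : (0 : ℝ) < 2 ^ (-κ) := by positivity
  have hr1 : (2 : ℝ) ^ (-κ) < 1 := Real.rpow_lt_one_of_one_lt_of_neg (by norm_num) (by linarith)
  have h := (tendsto_pow_const_mul_const_pow_of_abs_lt_one K (r := (2 : ℝ) ^ (-κ))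
    (by rwa [abs_of_pos hr0])).comp (tendsto_add_atTop_nat 1)
  have h2 := h.mul_const (((2 : ℝ) ^ (-κ))⁻¹)
  rw [zero_mul] at h2
  refine h2.congr fun n => ?_
  have : (2 : ℝ) ^ (-((n : ℝ) * κ)) = (2 ^ (-κ)) ^ n := by
    rw [← Real.rpow_natCast, ← Real.rpow_mul two_pos.le]
    ring_nf
  rw [this]
  simp only [Function.comp, Nat.cast_add, Nat.cast_one, pow_succ]
  field_simp

theorem half_le_floor {t : ℝ} (ht : 1 ≤ t) : t / 2 ≤ (⌊t⌋₊ : ℝ) := by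
  have h1 : (1 : ℝ) ≤ ⌊t⌋₊ := by exact_mod_cast Nat.one_le_floor_iff t |>.2 ht
  have h2 := Nat.lt_floor_add_one t
  linarith

/-- For `ρ = 0` the bin size is 1 and the factor vanishes, so no condition on `κ` is needed. This
covers coding without binning. -/
theorem tendsto_floor_sub_one_mul (K : ℕ) {ρ κ : ℝ} (h : ρ = 0 ∨ ρ < κ) :
    Tendsto (fun n : ℕ => ((⌊(2 : ℝ) ^ ((n : ℝ) * ρ)⌋₊ - 1 : ℕ) : ℝ) *
      (((n : ℝ) + 1) ^ K * (2 : ℝ) ^ (-((n : ℝ) * κ)))) atTop (𝓝 0) := by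
  rcases h with rfl | h
  · simp
  · refine squeeze_zero (fun n => by positivity) (fun n => ?_)
      (tendsto_poly_mul_rpow K (sub_pos.2 h))
    have h1 : ((⌊(2 : ℝ) ^ ((n : ℝ) * ρ)⌋₊ - 1 : ℕ) : ℝ) ≤ 2 ^ ((n : ℝ) * ρ) :=
      (Nat.cast_le.2 (Nat.sub_le _ _)).trans (Nat.floor_le (by positivity))
    calc _ ≤ (2 : ℝ) ^ ((n : ℝ) * ρ) * (((n : ℝ) + 1) ^ K * (2 : ℝ) ^ (-((n : ℝ) * κ))) :=
          mul_le_mul_of_nonneg_right h1 (by positivity)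
      _ = _ := by
          rw [mul_left_comm, ← Real.rpow_add two_pos]
          ring_nf

variable {S X Y : Type*} [Fintype S] [Fintype X] [Fintype Y]

/-- The bin rate is `ρ`, the rate inside a bin `ρ'`, and `ρ + ρ' - i` is the price of the union over
codewords after the change of measure. The strict inequalities make the error terms vanish: `hcov`,
`hc₁0` for covering, `hc₂0` for typicality with `y`, `hbin` for low-entropy competitors, and `hθ₁`,
`hθ₂` for the two ways of accepting under `Q`. -/
theorem eventually_exists_scheme_of_rates {W : X → S → ℝ} {V : Y → S → ℝ} {π : S → ℝ}
    {P Q : X × Y → ℝ}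
    (hW : ∀ x s, 0 < W x s) (hWs : ∀ x, ∑ s, W x s = 1)
    (hV : ∀ y s, 0 < V y s) (hVs : ∀ y, ∑ s, V y s = 1)
    (hπ : ∀ s, 0 < π s) (hπs : ∑ s, π s = 1)
    (hP : P ∈ stdSimplex ℝ (X × Y)) (hQ : Q ∈ stdSimplex ℝ (X × Y))
    {N₁ : Set (S × X → ℝ)} {N₂ : Set (S × Y → ℝ)} {N₃ : Set (Y → ℝ)}
    {i i' j k h c₁ c₂ d₁ d₂ : ℝ}
    (hi : ∀ q ∈ N₁, i ≤ meanLLR W π q) (hi' : ∀ q ∈ N₁, meanLLR W π q ≤ i')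
    (hk : ∀ q ∈ N₁, ∑ a, margFst q a * Real.logb 2 (π a) ≤ -k)
    (hj : ∀ q ∈ N₂, j ≤ meanLLR V π q) (hh : ∀ q ∈ N₂, h < condEntropy q)
    (hN₃ : ∀ q ∈ N₂, margSnd q ∈ N₃)
    (hc₁ : ∀ p ∈ stdSimplex ℝ (S × X × Y), margSX p ∉ N₁ →
      (c₁ : EReal) ≤ klDivergence p (joint W P))
    (hc₂ : ∀ p ∈ stdSimplex ℝ (S × X × Y), margSY p ∉ N₂ →
      (c₂ : EReal) ≤ klDivergence p (joint W P))
    (hd₁ : ∀ p ∈ stdSimplex ℝ (S × X × Y), margSX p ∈ N₁ → margSY p ∈ N₂ →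
      (d₁ : EReal) ≤ klDivergence p (joint W Q))
    (hd₂ : ∀ p ∈ stdSimplex ℝ (S × X × Y), margSX p ∈ N₁ → margY p ∈ N₃ →
      h < condEntropy (margSY p) → (d₂ : EReal) ≤ klDivergence p (joint W Q))
    {R ρ ρ' θ : ℝ} (hρ : 0 ≤ ρ) (hρ' : 0 ≤ ρ') (hρR : ρ ≤ R) (hcov : i' < ρ + ρ')
    (hc₁0 : 0 < c₁) (hc₂0 : ρ + ρ' - i < c₂) (hθ₁ : θ + (ρ + ρ' - i) < d₁)
    (hbin : ρ' = 0 ∨ ρ' < k - h - (ρ + ρ' - i))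
    (hθ₂ : ρ' = 0 ∨ ρ' < j + d₂ - θ - (ρ + ρ' - i)) {ε : ℝ} (hε : 0 < ε) :
    ∀ᶠ n : ℕ in atTop, ∃ c : Scheme X Y R n,
      guessProb P c 1 ≤ ε ∧ guessProb Q c 0 ≤ 2 ^ (-((n : ℝ) * θ)) := by
  set a : ℝ := ρ + ρ' - i with ha
  set D := Fintype.card (S × X × Y) with hD
  set D' := Fintype.card (S × Y) with hD'
  have t1 := (tendsto_poly_mul_rpow D hc₁0).const_mul 2
  -- The 8 comes from `2 / u`, where `u` carries a factor `1/4` because each of the two floors loses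
  -- at most a factor 2.
  have t2 := (tendsto_poly_mul_rpow 0 (sub_pos.2 hcov)).const_mul 8
  have t3 := tendsto_poly_mul_rpow D (sub_pos.2 hc₂0)
  have t4 := tendsto_floor_sub_one_mul D' hbin
  have t5 := tendsto_poly_mul_rpow D (sub_pos.2 hθ₁)
  have t6 := tendsto_floor_sub_one_mul D hθ₂
  have t := (((t1.add t2).add t3).add t4).div_const ε |>.add (t5.add t6)
  simp only [mul_zero, add_zero, zero_div] at t
  filter_upwards [t.eventually (gt_mem_nhds one_pos), eventually_gt_atTop 0] with n hn hn0
  have hnn : (0 : ℝ) ≤ n := Nat.cast_nonneg n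
  have hBL : ∀ r : ℝ, 0 ≤ r → (2 : ℝ) ^ ((n : ℝ) * r) / 2 ≤ (⌊(2 : ℝ) ^ ((n : ℝ) * r)⌋₊ : ℝ) :=
    fun r hr => half_le_floor (Real.one_le_rpow (by norm_num) (by positivity))
  have hBL' : ∀ r : ℝ, (⌊(2 : ℝ) ^ ((n : ℝ) * r)⌋₊ : ℝ) ≤ (2 : ℝ) ^ ((n : ℝ) * r) :=
    fun r => Nat.floor_le (by positivity)
  refine exists_scheme hW hWs hV hVs hπ hπs hP hQ hi hi' hk hj hh hN₃ hc₁ hc₂ hd₁ hd₂ hn0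
    (B := ⌊(2 : ℝ) ^ ((n : ℝ) * ρ)⌋₊) (L := ⌊(2 : ℝ) ^ ((n : ℝ) * ρ')⌋₊)
    (u := 2 ^ ((n : ℝ) * (ρ + ρ' - i')) / 4) (M := 2 ^ ((n : ℝ) * a))
    ?_ (by positivity) hε (by positivity) ?_ ?_ ?_
  · refine Nat.floor_le_floor (Real.rpow_le_rpow_of_exponent_le (by norm_num) ?_)
    gcongr
  · calc (2 : ℝ) ^ ((n : ℝ) * (ρ + ρ' - i')) / 4 =
          (2 ^ ((n : ℝ) * ρ) / 2) * (2 ^ ((n : ℝ) * ρ') / 2) * 2 ^ (-((n : ℝ) * i')) := by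
          rw [show (n : ℝ) * (ρ + ρ' - i') = n * ρ + n * ρ' + -(n * i') by ring,
            Real.rpow_add two_pos, Real.rpow_add two_pos]
          ring
      _ ≤ _ := by
          rw [Nat.cast_mul]
          gcongr
          · exact hBL _ hρ
          · exact hBL _ hρ'
  · calc _ ≤ ((2 : ℝ) ^ ((n : ℝ) * ρ) * 2 ^ ((n : ℝ) * ρ')) * 2 ^ (-((n : ℝ) * i)) := by
          rw [Nat.cast_mul]
          gcongr
          · exact hBL' _
          · exact hBL' _
      _ = _ := by
          rw [← Real.rpow_add two_pos, ← Real.rpow_add two_pos]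
          congr 1
          rw [ha]
          ring
  · refine lt_of_eq_of_lt ?_ hn
    have e : ∀ s t u : ℝ, s = t + u → (2 : ℝ) ^ s = 2 ^ t * 2 ^ u := fun s t u h => by
      rw [h, Real.rpow_add two_pos]
    have e2 : 2 / ((2 : ℝ) ^ ((n : ℝ) * (ρ + ρ' - i')) / 4) =
        8 * (((n : ℝ) + 1) ^ 0 * 2 ^ (-((n : ℝ) * (ρ + ρ' - i')))) := by
      rw [Real.rpow_neg two_pos.le]
      field_simp
      norm_num
    have e3 := e (-((n : ℝ) * (c₂ - a))) (n * a) (-(n * c₂)) (by ring)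
    have e4 := e (-((n : ℝ) * (k - h - a))) (n * a) (-(n * (k - h))) (by ring)
    have e5 := e (-((n : ℝ) * (d₁ - (θ + a)))) (n * a + n * θ) (-(n * d₁)) (by ring)
    have e6 := e (-((n : ℝ) * (j + d₂ - θ - a))) (n * a + n * θ) (-(n * j) + -(n * d₂)) (by ring)
    rw [e2, e3, e4, e5, e6, Real.rpow_neg two_pos.le ((n : ℝ) * θ), div_inv_eq_mul,
      Real.rpow_add two_pos, Real.rpow_add two_pos]
    ring

/-- A uniform version of the constraints defining a compact set of pmfs. -/
theorem exists_pos_forall_lt_klDivergence {A : Type*} [Fintype A] {r : A → ℝ}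
    (hr : ∀ a, 0 ≤ r a) {d : ℝ} {K : ℝ → (A → ℝ) → Prop}
    (hK : IsClosed {z : ℝ × (A → ℝ) | K z.1 z.2})
    (h : ∀ p ∈ stdSimplex ℝ A, K 0 p → (d : EReal) < klDivergence p r) :
    ∃ η > 0, ∀ p ∈ stdSimplex ℝ A, K η p → (d : EReal) < klDivergence p r := by
  have := eventually_forall_lt_klDivergence (T := ℝ) (t₀ := 0) (r := fun _ => r)
    (d := fun _ => d) (K := K) continuousAt_const hr continuousAt_const
    (fun p hp => hK.isOpen_compl.mem_nhds hp) h
  obtain ⟨η, hη, hη0⟩ := ((this.filter_mono nhdsWithin_le_nhds).and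
    (self_mem_nhdsWithin (a := (0 : ℝ)) (s := Set.Ioi 0))).exists
  exact ⟨η, hη0, fun p hp hKp => hη p hp hr hKp⟩

/-- The conditional pmf `P_{S|Y}` of a pmf of `(S, Y)`, completed arbitrarily to a channel. -/
def condChannel (p : S × Y → ℝ) (y : Y) (s : S) : ℝ :=
  if margSnd p y = 0 then margFst p s else p (s, y) / margSnd p y

theorem condChannel_mul {p : S × Y → ℝ} (hp : ∀ a, 0 ≤ p a) :
    (fun a : S × Y => condChannel p a.2 a.1 * margSnd p a.2) = p := by
  funext a
  by_cases h : margSnd p a.2 = 0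
  · have := (Finset.sum_eq_zero_iff_of_nonneg fun s _ => hp (s, a.2)).1 h a.1 (Finset.mem_univ _)
    rw [h, mul_zero]
    exact this.symm
  · rw [condChannel, if_neg h, div_mul_cancel₀ _ h]

theorem sum_condChannel {p : S × Y → ℝ} (hp : p ∈ stdSimplex ℝ (S × Y)) (y : Y) :
    ∑ s, condChannel p y s = 1 := by
  unfold condChannel
  split_ifs with h
  · exact (margFst_mem hp).2
  · rw [← Finset.sum_div]
    exact div_self h

/-- The order of choices avoids circularity. First `η` and `γ` fix `N₂` and hence its exponent `c₂`;
then the excess rate `μ` is taken small against `c₂`, since the union over codewords must be beaten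
by `c₂`; only then is `N₁` shrunk in terms of `μ`. -/
theorem eventually_exists_scheme {W : X → S → ℝ} {P Q : X × Y → ℝ}
    (hW : ∀ x s, 0 < W x s) (hWs : ∀ x, ∑ s, W x s = 1)
    (hP : P ∈ stdSimplex ℝ (X × Y)) (hQ : Q ∈ stdSimplex ℝ (X × Y)) {R θ d₁ : ℝ}
    (hd₁ : ∀ p ∈ matchingSet (joint W P), (d₁ : EReal) < klDivergence p (joint W Q))
    (hθ₁ : θ < d₁)
    (hR : mutualInfo (margSX (joint W P)) < R ∨
      (condMutualInfo (joint W P) < R ∧ R ≤ mutualInfo (margSX (joint W P)) ∧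
        ∃ d₂ : ℝ, (∀ p ∈ binningSet (joint W P), (d₂ : EReal) < klDivergence p (joint W Q)) ∧
          θ < d₂ + (R - condMutualInfo (joint W P)))) {ε : ℝ} (hε : 0 < ε) :
    ∀ᶠ n : ℕ in atTop, ∃ c : Scheme X Y R n,
      guessProb P c 1 ≤ ε ∧ guessProb Q c 0 ≤ 2 ^ (-((n : ℝ) * θ)) := by
  have hWm : ∀ x, W x ∈ stdSimplex ℝ S := fun x => ⟨fun s => (hW x s).le, hWs x⟩
  have hJ := joint_mem hP hWm
  set p₀ := joint W P with hp₀
  have hQJ : ∀ a, 0 ≤ joint W Q a := (joint_mem hQ hWm).1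
  have hSX := margSX_mem hJ
  have hSY := margSY_mem hJ
  set π := margFst (margSX p₀) with hπdef
  set V := condChannel (margSY p₀) with hVdef
  set I := mutualInfo (margSX p₀) with hI
  set J := mutualInfo (margSY p₀) with hJdef
  set H := condEntropy (margSY p₀) with hH
  have hπm : π ∈ stdSimplex ℝ S := margFst_mem hSX
  have hcI : condMutualInfo p₀ = I - J := condMutualInfo_joint P hWs
  obtain ⟨a₀, ha₀⟩ : ∃ a, 0 < P a := by
    by_contra! hcon
    have := hP.2
    rw [Finset.sum_eq_zero fun a _ => le_antisymm (hcon a) (hP.1 a)] at this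
    exact zero_ne_one this
  have hp₀nn := hJ.1
  have hpos : ∀ s, 0 < p₀ (s, a₀) := fun s => mul_pos (hW _ _) ha₀
  have hπ : ∀ s, 0 < π s := by
    intro s
    have h1 : 0 < margSX p₀ (s, a₀.1) := (hpos s).trans_le
      (Finset.single_le_sum (f := fun y => p₀ (s, a₀.1, y)) (fun y _ => hp₀nn _)
        (Finset.mem_univ a₀.2))
    exact h1.trans_le (Finset.single_le_sum (f := fun x => margSX p₀ (s, x))
      (fun x _ => hSX.1 _) (Finset.mem_univ a₀.1))
  -- For `y` of mass zero the completion of `V` is `π`, itself positive, so likelihood ratios are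
  -- positive everywhere.
  have hV : ∀ y s, 0 < V y s := by
    intro y s
    rw [hVdef, condChannel, margFst_margSY]
    split_ifs with h
    · exact hπ s
    · have h0 : 0 < margSnd (margSY p₀) y :=
        lt_of_le_of_ne ((margSnd_mem hSY).1 y) (Ne.symm h)
      refine div_pos ?_ h0
      rw [margSnd_margSY] at h0
      change 0 < ∑ x, margXY p₀ (x, y) at h0
      rw [margXY_joint P hWs] at h0
      obtain ⟨x, -, hx⟩ := Finset.exists_lt_of_sum_lt (s := Finset.univ) (f := fun _ => (0 : ℝ))
        (g := fun x => P (x, y)) (by simpa using h0)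
      exact (mul_pos (hW x s) hx).trans_le (Finset.single_le_sum (f := fun x => p₀ (s, x, y))
        (fun y _ => hp₀nn _) (Finset.mem_univ x))
  have hVs : ∀ y, ∑ s, V y s = 1 := sum_condChannel hSY
  have hℓ₁ : meanLLR W π (margSX p₀) = I := by
    have e := margSX_joint W P
    rw [hI, hp₀, e]
    exact (mutualInfo_channel hW hWs (margFst_mem hP).1 (by rw [hπdef, hp₀, e])).symm
  have hℓ₂ : meanLLR V π (margSY p₀) = J := by
    have e := condChannel_mul hSY.1
    have h := mutualInfo_channel (π := π) hV hVs (margSnd_mem hSY).1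
      (by rw [hVdef, e, margFst_margSY])
    rw [hVdef, e] at h
    exact h.symm
  have hJH : J = entropy π - H := by rw [hJdef, mutualInfo, margFst_margSY]
  -- uniform exponents near the constraint sets
  have cX := continuous_margSX.comp (continuous_snd (X := ℝ) (Y := S × X × Y → ℝ))
  have cS := continuous_margSY.comp (continuous_snd (X := ℝ) (Y := S × X × Y → ℝ))
  have cY := continuous_margY.comp (continuous_snd (X := ℝ) (Y := S × X × Y → ℝ))
  obtain ⟨η₁, hη₁, hη₁'⟩ := exists_pos_forall_lt_klDivergence hQJ (d := d₁)
    (K := fun η p => dist (margSX p) (margSX p₀) ≤ η ∧ dist (margSY p) (margSY p₀) ≤ η)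
    ((isClosed_le (cX.dist continuous_const) continuous_fst).inter
      (isClosed_le (cS.dist continuous_const) continuous_fst))
    (fun p hp hK => hd₁ p ⟨hp, dist_le_zero.1 hK.1, dist_le_zero.1 hK.2⟩)
  obtain ⟨η, hη, hηη₁, d₂, hd₂, hθ₂⟩ : ∃ η > 0, η ≤ η₁ ∧ ∃ d₂ : ℝ,
      (∀ p ∈ stdSimplex ℝ (S × X × Y), dist (margSX p) (margSX p₀) ≤ η →
        dist (margY p) (margY p₀) ≤ η → H - η ≤ condEntropy (margSY p) →
          (d₂ : EReal) ≤ klDivergence p (joint W Q)) ∧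
      (I < R ∨ (I - J < R ∧ R ≤ I ∧ θ < d₂ + (R - (I - J)))) := by
    rcases hR with hR | ⟨hR1, hR2, d₂, hd₂, hθ₂⟩
    -- Without binning the second exponent plays no role, and 0 is a valid bound because divergence
    -- is nonnegative.
    · refine ⟨η₁, hη₁, le_rfl, 0, fun p hp _ _ _ => ?_, Or.inl hR⟩
      by_cases hne : p = joint W Q
      · subst hne
        simp only [klDivergence, imp_self, implies_true, if_true]
        refine EReal.coe_nonneg.2 (Finset.sum_nonneg fun a _ => ?_)
        by_cases h0 : joint W Q a = 0
        · simp [h0]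
        · simp [div_self h0]
      · exact (klDivergence_pos hp (joint_mem hQ hWm) hne).le
    · obtain ⟨η₂, hη₂, hη₂'⟩ := exists_pos_forall_lt_klDivergence hQJ (d := d₂)
        (K := fun η p => dist (margSX p) (margSX p₀) ≤ η ∧ dist (margY p) (margY p₀) ≤ η ∧
          H - η ≤ condEntropy (margSY p))
        ((isClosed_le (cX.dist continuous_const) continuous_fst).inter
          ((isClosed_le (cY.dist continuous_const) continuous_fst).inter
            (isClosed_le (continuous_const.sub continuous_fst)
              (continuous_condEntropy.comp cS))))
        (fun p hp hK => hd₂ p ⟨hp, dist_le_zero.1 hK.1, dist_le_zero.1 hK.2.1, by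
          have := hK.2.2
          rwa [sub_zero] at this⟩)
      refine ⟨min η₁ η₂, lt_min hη₁ hη₂, min_le_left _ _, d₂, fun p hp h1 h2 h3 => ?_,
        Or.inr ⟨hcI ▸ hR1, hR2, by rwa [← hcI]⟩⟩
      have h4 := min_le_right η₁ η₂
      exact (hη₂' p hp ⟨h1.trans h4, h2.trans h4, by linarith⟩).le
  obtain ⟨γ, hγ, hγ'⟩ : ∃ γ > 0, I < R ∨
      (γ < R - (I - J) ∧ R ≤ I ∧ γ < d₂ + (R - (I - J)) - θ) := by
    rcases hθ₂ with h | ⟨h1, h2, h3⟩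
    · exact ⟨1, one_pos, Or.inl h⟩
    · obtain ⟨γ, hγ0, hγ1⟩ := exists_between
        (lt_min (sub_pos.2 h1) (sub_pos.2 h3))
      exact ⟨γ, hγ0, Or.inr ⟨hγ1.trans_le (min_le_left _ _), h2, hγ1.trans_le (min_le_right _ _)⟩⟩
  -- the neighbourhood for `(S, Y)`
  set N₃ : Set (Y → ℝ) := {m | dist m (margY p₀) < η} with hN₃
  set N₂ : Set (S × Y → ℝ) := {q | J - γ < meanLLR V π q ∧ H - η < condEntropy q ∧
    dist (margSnd q) (margY p₀) < η ∧ dist q (margSY p₀) < η} with hN₂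
  have oN₂ : IsOpen N₂ :=
    (isOpen_lt continuous_const (continuous_meanLLR V π)).inter
      ((isOpen_lt continuous_const continuous_condEntropy).inter
        ((isOpen_lt (continuous_margSnd.dist continuous_const) continuous_const).inter
          (isOpen_lt (continuous_id.dist continuous_const) continuous_const)))
  have mN₂ : margSY p₀ ∈ N₂ := by
    refine ⟨by rw [hℓ₂]; linarith, by rw [← hH]; linarith, ?_, ?_⟩
    · rw [margSnd_margSY, dist_self]
      exact hη
    · rw [dist_self]
      exact hη
  obtain ⟨c₂, hc₂0, hc₂⟩ := exists_pos_le_klDivergence hJ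
    (oN₂.preimage continuous_margSY) mN₂
  -- the excess rate of the codebook
  obtain ⟨μ, hμ0, hμ1, hμ2, hμ3⟩ : ∃ μ > 0, 3 * μ < c₂ ∧ θ + 3 * μ < d₁ ∧
      (I + μ ≤ R ∨ (γ + 3 * μ < R - (I - J) ∧ R ≤ I ∧
        γ + 3 * μ < d₂ + (R - (I - J)) - θ)) := by
    rcases hγ' with h | ⟨h1, h2, h3⟩
    · obtain ⟨μ, h0, h1⟩ := exists_between
        (lt_min (lt_min hc₂0 (sub_pos.2 hθ₁)) (sub_pos.2 h))
      simp only [lt_min_iff] at h1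
      exact ⟨μ / 3, by positivity, by linarith, by linarith, Or.inl (by linarith)⟩
    · obtain ⟨μ, h0, h1⟩ := exists_between
        (lt_min (lt_min hc₂0 (sub_pos.2 hθ₁)) (lt_min (sub_pos.2 h1) (sub_pos.2 h3)))
      simp only [lt_min_iff] at h1
      exact ⟨μ / 3, by positivity, by linarith, by linarith,
        Or.inr ⟨by linarith, h2, by linarith⟩⟩
  -- the neighbourhood for `(S, X)`
  have cπ : Continuous fun q : S × X → ℝ => ∑ a, margFst q a * Real.logb 2 (π a) :=
    continuous_finsetSum _ fun a _ =>
      ((continuous_apply a).comp continuous_margFst).mul continuous_const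
  set N₁ : Set (S × X → ℝ) := {q | I - μ / 2 < meanLLR W π q ∧ meanLLR W π q < I + μ / 2 ∧
    ∑ a, margFst q a * Real.logb 2 (π a) < -(entropy π - γ) ∧ dist q (margSX p₀) < η} with hN₁
  have oN₁ : IsOpen N₁ :=
    (isOpen_lt continuous_const (continuous_meanLLR W π)).inter
      ((isOpen_lt (continuous_meanLLR W π) continuous_const).inter
        ((isOpen_lt cπ continuous_const).inter
          (isOpen_lt (continuous_id.dist continuous_const) continuous_const)))
  have mN₁ : margSX p₀ ∈ N₁ := by
    refine ⟨by rw [hℓ₁]; linarith, by rw [hℓ₁]; linarith, ?_, ?_⟩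
    · have : ∑ a, π a * Real.logb 2 (π a) = -entropy π := by rw [entropy, neg_neg]
      rw [← hπdef, this]
      linarith
    · rw [dist_self]
      exact hη
  obtain ⟨c₁, hc₁0, hc₁⟩ := exists_pos_le_klDivergence hJ
    (oN₁.preimage continuous_margSX) mN₁
  have hI0 : 0 ≤ I := mutualInfo_nonneg hSX
  -- The total rate `I + μ` exceeds the upper bound `I + μ / 2` of the log-likelihood ratio on `N₁`,
  -- as covering requires, and exceeds the lower bound `I - μ / 2` by `3 * μ / 2`, the union price.
  -- Either everything fits into the message rate, or `ρ = R` and the rest is binned.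
  obtain ⟨ρ, ρ', hρ, hρ', hρR, hsum, hbin, hθ'⟩ : ∃ ρ ρ' : ℝ, 0 ≤ ρ ∧ 0 ≤ ρ' ∧ ρ ≤ R ∧
      ρ + ρ' = I + μ ∧ (ρ' = 0 ∨ ρ' < J - γ - 3 * μ / 2) ∧
        (ρ' = 0 ∨ ρ' < J - γ + d₂ - θ - 3 * μ / 2) := by
    rcases hμ3 with h | ⟨h1, h2, h3⟩
    · exact ⟨I + μ, 0, by linarith, le_rfl, h, add_zero _, Or.inl rfl, Or.inl rfl⟩
    · have := condMutualInfo_nonneg hp₀nn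
      exact ⟨R, I + μ - R, by linarith, by linarith, le_rfl, by ring, Or.inr (by linarith),
        Or.inr (by linarith)⟩
  refine eventually_exists_scheme_of_rates hW hWs hV hVs hπ hπm.2 hP hQ (N₁ := N₁) (N₂ := N₂)
    (N₃ := N₃) (i := I - μ / 2) (i' := I + μ / 2) (j := J - γ) (k := entropy π - γ) (h := H - η)
    (c₁ := c₁) (c₂ := c₂) (d₁ := d₁) (d₂ := d₂)
    (fun q hq => hq.1.le) (fun q hq => hq.2.1.le) (fun q hq => hq.2.2.1.le)
    (fun q hq => hq.1.le) (fun q hq => hq.2.1) (fun q hq => hq.2.2.1) hc₁ hc₂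
    (fun p hp h1 h2 => (hη₁' p hp ⟨h1.2.2.2.le.trans hηη₁, h2.2.2.2.le.trans hηη₁⟩).le)
    (fun p hp h1 h2 h3 => hd₂ p hp h1.2.2.2.le (le_of_lt h2) h3.le)
    hρ hρ' hρR (by linarith) hc₁0 (by linarith) (by linarith) ?_ ?_ hε
  · exact hbin.imp_right fun h => by linarith
  · exact hθ'.imp_right fun h => by linarith

end Asymptotics

/-! ### From schemes to the exponent-rate function; the one-bit test -/

section Achievability

variable {X Y : Type*} [Fintype X] [Fintype Y]

theorem sum_prod_pairs {P : X × Y → ℝ} (hP : P ∈ stdSimplex ℝ (X × Y)) (n : ℕ) :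
    ∑ x : Fin n → X, ∑ y : Fin n → Y, ∏ i, P (x i, y i) = 1 := by
  have h := sum_prodProb P n
  rw [hP.2, one_pow, sum_seq_prod] at h
  exact h

theorem guessProb_nonneg {P : X × Y → ℝ} (hP : ∀ a, 0 ≤ P a) {R : ℝ} {n : ℕ}
    (c : Scheme X Y R n) (h : Fin 2) : 0 ≤ guessProb P c h :=
  Finset.sum_nonneg fun x _ => Finset.sum_nonneg fun y _ =>
    mul_nonneg (Finset.prod_nonneg fun i _ => hP _)
      (Finset.sum_nonneg fun m _ => mul_nonneg ((c.enc_mem x).1 m) (by positivity))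

/-- The scheme that always accepts the null hypothesis. -/
theorem exists_accepting_scheme (X Y : Type*) [Fintype X] [Fintype Y] (R : ℝ) (n : ℕ) :
    ∃ c : Scheme X Y R n, (∀ P, guessProb P c 1 = 0) ∧
      ∀ P ∈ stdSimplex ℝ (X × Y), guessProb P c 0 ≤ 1 := by
  obtain ⟨c, hc⟩ := exists_scheme_of_code (R := R) (n := n) (B := 0) (Nat.zero_le _)
    (fun _ : Fin n → X => 0) (fun (_ : Fin n → Y) _ => 0)
  refine ⟨c, fun P => ?_, fun P hP => ?_⟩
  · rw [hc]
    simp [ind]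
  · rw [hc]
    simp [ind, sum_prod_pairs hP]

theorem elogTwo_le {n : ℕ} (hn : 0 < n) {β θ : ℝ} (hβ : 0 ≤ β) (h : β ≤ 2 ^ (-((n : ℝ) * θ))) :
    ((1 / (n : ℝ) : ℝ) : EReal) * elogTwo β ≤ ((-θ : ℝ) : EReal) := by
  have hn' : (0 : ℝ) < n := by exact_mod_cast hn
  unfold elogTwo
  split_ifs with h0
  · rw [EReal.coe_mul_bot_of_pos (by positivity)]
    exact bot_le
  · rw [← EReal.coe_mul, EReal.coe_le_coe_iff]
    have hb : 0 < β := lt_of_le_of_ne hβ (Ne.symm h0)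
    have := (Real.logb_le_iff_le_rpow (by norm_num : (1 : ℝ) < 2) hb).2 h
    rw [one_div, inv_mul_le_iff₀ hn']
    linarith

/-- The constraint on `α_n` concerns every `n`, so blocklengths without a good scheme use the
always-accepting one, which has `α_n = 0`; the limsup does not see them. -/
theorem isAchievable_of_eventually {P Q : X × Y → ℝ} (hQ : ∀ a, 0 ≤ Q a) {R ε θ : ℝ}
    (hε : 0 < ε)
    (h : ∀ᶠ n : ℕ in atTop, ∃ c : Scheme X Y R n,
      guessProb P c 1 ≤ ε ∧ guessProb Q c 0 ≤ 2 ^ (-((n : ℝ) * θ))) :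
    IsAchievable P Q R ε θ := by
  have key : ∀ n : ℕ, ∃ c : Scheme X Y R n, guessProb P c 1 ≤ ε ∧
      ((∃ c : Scheme X Y R n, guessProb P c 1 ≤ ε ∧ guessProb Q c 0 ≤ 2 ^ (-((n : ℝ) * θ))) →
        guessProb Q c 0 ≤ 2 ^ (-((n : ℝ) * θ))) := by
    intro n
    by_cases hn : ∃ c : Scheme X Y R n,
        guessProb P c 1 ≤ ε ∧ guessProb Q c 0 ≤ 2 ^ (-((n : ℝ) * θ))
    · obtain ⟨c, h1, h2⟩ := hn
      exact ⟨c, h1, fun _ => h2⟩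
    · obtain ⟨c, hc, -⟩ := exists_accepting_scheme X Y R n
      exact ⟨c, by rw [hc]; exact hε.le, fun h => absurd h hn⟩
  choose c h1 h2 using key
  refine ⟨c, fun n _ => h1 n, ?_⟩
  rw [EReal.le_neg, ← EReal.coe_neg]
  refine limsup_le_of_le (h := ?_)
  filter_upwards [h, eventually_gt_atTop 0] with n hn hn0
  exact elogTwo_le hn0 (guessProb_nonneg hQ _ _) (h2 n hn)

/-- A supremum is reached through all real `θ < v`; negative `θ` lie below the exponent 0 of the
always-accepting scheme. -/
theorem le_exponentRate {P Q : X × Y → ℝ} (hQ : Q ∈ stdSimplex ℝ (X × Y)) {R : ℝ} {v : EReal}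
    (h : ∀ θ : ℝ, (θ : EReal) < v → ∀ ε : ℝ, 0 < ε → ∀ᶠ n : ℕ in atTop,
      ∃ c : Scheme X Y R n, guessProb P c 1 ≤ ε ∧ guessProb Q c 0 ≤ 2 ^ (-((n : ℝ) * θ))) :
    v ≤ exponentRate P Q R := by
  have h0 : (0 : EReal) ≤ exponentRate P Q R := by
    refine le_sSup ⟨0, by simp, le_rfl, fun ε hε => isAchievable_of_eventually hQ.1 hε ?_⟩
    refine Eventually.of_forall fun n => ?_
    obtain ⟨c, hc, hc'⟩ := exists_accepting_scheme X Y R n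
    exact ⟨c, by rw [hc]; exact hε.le, by simpa using hc' Q hQ⟩
  refine le_of_forall_lt fun w hw => ?_
  obtain ⟨θ, hθ1, hθ2⟩ := EReal.lt_iff_exists_real_btwn.1 hw
  refine hθ1.trans_le ?_
  rcases le_or_gt 0 θ with hθ | hθ
  · exact le_sSup ⟨θ, rfl, hθ, fun ε hε => isAchievable_of_eventually hQ.1 hε (h θ hθ2 ε hε)⟩
  · exact (EReal.coe_le_coe_iff.2 hθ.le).trans (by simpa using h0)

open Topology in
/-- One bit suffices to compare both marginals with those of the null hypothesis. -/
theorem eventually_exists_one_bit_scheme {P Q : X × Y → ℝ} (hP : P ∈ stdSimplex ℝ (X × Y))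
    (hQ : Q ∈ stdSimplex ℝ (X × Y)) {R θ d : ℝ} (hR : 0 ≤ R) (hθ : θ < d)
    (hd : ∀ p ∈ stdSimplex ℝ (X × Y), margFst p = margFst P → margSnd p = margSnd P →
      (d : EReal) < klDivergence p Q) {ε : ℝ} (hε : 0 < ε) :
    ∀ᶠ n : ℕ in atTop, ∃ c : Scheme X Y R n,
      guessProb P c 1 ≤ ε ∧ guessProb Q c 0 ≤ 2 ^ (-((n : ℝ) * θ)) := by
  classical
  obtain ⟨η, hη, hη'⟩ := exists_pos_forall_lt_klDivergence hQ.1 (d := d)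
    (K := fun η p => dist (margFst p) (margFst P) ≤ η ∧ dist (margSnd p) (margSnd P) ≤ η)
    ((isClosed_le ((continuous_margFst.comp continuous_snd).dist continuous_const)
      continuous_fst).inter
      (isClosed_le ((continuous_margSnd.comp continuous_snd).dist continuous_const)
        continuous_fst))
    (fun p hp hK => hd p hp (dist_le_zero.1 hK.1) (dist_le_zero.1 hK.2))
  set N : Set (X × Y → ℝ) :=
    {p | dist (margFst p) (margFst P) < η ∧ dist (margSnd p) (margSnd P) < η} with hN
  have oN : IsOpen N :=
    (isOpen_lt (continuous_margFst.dist continuous_const) continuous_const).inter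
      (isOpen_lt (continuous_margSnd.dist continuous_const) continuous_const)
  obtain ⟨c, hc0, hc⟩ := exists_pos_le_klDivergence hP oN
    (show P ∈ N from ⟨by rwa [dist_self], by rwa [dist_self]⟩)
  set D := Fintype.card (X × Y) with hD
  have t1 := tendsto_poly_mul_rpow D hc0
  have t2 := tendsto_poly_mul_rpow D (sub_pos.2 hθ)
  filter_upwards [t1.eventually (gt_mem_nhds hε), t2.eventually (gt_mem_nhds one_pos),
    eventually_gt_atTop 0] with n h1 h2 hn
  -- Even at `R = 0` the message set `{0, …, ⌊2^{nR}⌋}` has two elements, enough to report whether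
  -- `x` is typical.
  have hB : 1 ≤ ⌊(2 : ℝ) ^ ((n : ℝ) * R)⌋₊ := by
    rw [Nat.one_le_floor_iff]
    exact Real.one_le_rpow (by norm_num) (by positivity)
  obtain ⟨s, hs⟩ := exists_scheme_of_code hB
    (fun x : Fin n → X => if dist (empirical x) (margFst P) < η then (1 : Fin 2) else 0)
    (fun (y : Fin n → Y) m =>
      if m = 1 ∧ dist (empirical y) (margSnd P) < η then (0 : Fin 2) else 1)
  have hacc : ∀ (x : Fin n → X) (y : Fin n → Y),
      ((if (if dist (empirical x) (margFst P) < η then (1 : Fin 2) else 0) = 1 ∧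
        dist (empirical y) (margSnd P) < η then (0 : Fin 2) else 1) = 0) ↔
          (empirical fun i => (x i, y i)) ∈ N := by
    intro x y
    rw [hN, Set.mem_ofPred_eq, margFst_empirical, margSnd_empirical]
    by_cases hx : dist (empirical x) (margFst P) < η <;>
      by_cases hy : dist (empirical y) (margSnd P) < η <;> simp [hx, hy]
  have hone : ∀ m : Fin 2, m = 1 ↔ ¬ m = 0 := by decide
  have hrej := fun x y => (hone _).trans (not_congr (hacc x y))
  have hsum : ∀ (P' : X × Y → ℝ) (E : (Fin n → X × Y) → Prop),
      ∑ x : Fin n → X, ∑ y : Fin n → Y, (∏ i, P' (x i, y i)) * ind (E fun i => (x i, y i)) =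
        ∑ z, if E z then prodProb P' z else 0 := by
    intro P' E
    rw [sum_seq_prod]
    refine Finset.sum_congr rfl fun x _ => Finset.sum_congr rfl fun y _ => ?_
    rw [ind, mul_ite, mul_one, mul_zero]
    rfl
  refine ⟨s, ?_, ?_⟩
  · rw [hs]
    simp only [hrej]
    rw [hsum P fun z => empirical z ∉ N]
    refine le_trans ?_ h1.le
    exact sanov_upper hP.1 hn _ fun z hz => hc _ (empirical_mem hn z) hz
  · rw [hs]
    simp only [hacc]
    rw [hsum Q fun z => empirical z ∈ N]
    refine (sanov_upper hQ.1 hn _ fun z hz => (hη' _ (empirical_mem hn z)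
      ⟨hz.1.le, hz.2.le⟩).le).trans ?_
    have e : (2 : ℝ) ^ (-((n : ℝ) * d)) = 2 ^ (-((n : ℝ) * (d - θ))) * 2 ^ (-((n : ℝ) * θ)) := by
      rw [← Real.rpow_add two_pos]
      ring_nf
    rw [e, ← mul_assoc]
    exact mul_le_of_le_one_left (by positivity) h2.le

end Achievability

/-! ### Rate zero: reduction to the two marginals -/

section Markov

variable {S X Y : Type*} [Fintype S] [Fintype X] [Fintype Y]

/-- The common channel cancels in each likelihood ratio; without absolute continuity the right side
is `⊤`. -/
theorem klDivergence_joint_le {W : X → S → ℝ} (hWs : ∀ x, ∑ s, W x s = 1) (p Q : X × Y → ℝ) :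
    klDivergence (joint W p) (joint W Q) ≤ klDivergence p Q := by
  by_cases h : ∀ a, Q a = 0 → p a = 0
  · have h' : ∀ a : S × X × Y, joint W Q a = 0 → joint W p a = 0 := fun a ha => by
      rcases mul_eq_zero.1 ha with h1 | h1
      · exact mul_eq_zero_of_left h1 _
      · exact mul_eq_zero_of_right _ (h _ h1)
    rw [klDivergence, klDivergence, if_pos h, if_pos h', EReal.coe_le_coe_iff,
      Fintype.sum_prod_type, Finset.sum_comm]
    refine (Finset.sum_congr rfl fun z _ => ?_).le
    rw [← one_mul (p z * _), ← hWs z.1, Finset.sum_mul]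
    refine Finset.sum_congr rfl fun s _ => ?_
    simp only [joint]
    by_cases hw : W z.1 s = 0
    · simp [hw]
    · rw [mul_div_mul_left _ _ hw, mul_assoc]
  · rw [klDivergence, klDivergence, if_neg h]
    exact le_top

/-- Under `joint W p`, `H(S|Y) ≥ H(S|X,Y) = H(S|X)`. The last term is the same for `P`, where it
equals `H(S|Y)` because `I(S;X|Y) = 0`. -/
theorem joint_mem_binningSet {W : X → S → ℝ} (hW : ∀ x, W x ∈ stdSimplex ℝ S) {P p : X × Y → ℝ}
    (hp : p ∈ stdSimplex ℝ (X × Y)) (h1 : margFst p = margFst P) (h2 : margSnd p = margSnd P)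
    (hI : condMutualInfo (joint W P) ≤ 0) : joint W p ∈ binningSet (joint W P) := by
  have hWs : ∀ x, ∑ s, W x s = 1 := fun x => (hW x).2
  refine ⟨joint_mem hp hW, ?_, ?_, ?_⟩
  · rw [margSX_joint, margSX_joint, h1]
  · rw [margY, margXY_joint p hWs, margY, margXY_joint P hWs, h2]
  · have h3 := condMutualInfo_nonneg (joint_mem hp hW).1
    rw [condMutualInfo, condEntropy_joint p hWs, h1] at h3
    rw [condMutualInfo, condEntropy_joint P hWs] at hI
    linarith

/-- Zero mutual information makes `W x` equal to `π` for every `x` of positive mass, so the `(S,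
Y)`-marginal is `π` times the `Y`-marginal for every law with the same `X`-marginal. -/
theorem joint_mem_matchingSet {W : X → S → ℝ} (hW : ∀ x, W x ∈ stdSimplex ℝ S) {P p : X × Y → ℝ}
    (hP : P ∈ stdSimplex ℝ (X × Y))
    (hp : p ∈ stdSimplex ℝ (X × Y)) (h1 : margFst p = margFst P) (h2 : margSnd p = margSnd P)
    (hI : mutualInfo (margSX (joint W P)) ≤ 0) : joint W p ∈ matchingSet (joint W P) := by
  have hWs : ∀ x, ∑ s, W x s = 1 := fun x => (hW x).2
  have heq := eq_prod_margins_of_mutualInfo_nonpos (margSX_mem (joint_mem hP hW)) hI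
  set π := margFst (margSX (joint W P))
  have hm : margSnd (margSX (joint W P)) = margFst P := by
    rw [margSX_joint]
    funext x
    simp only [margSnd, ← Finset.sum_mul, hWs, one_mul]
  rw [hm, margSX_joint] at heq
  have key : ∀ q : X × Y → ℝ, (∀ a, 0 ≤ q a) → margFst q = margFst P →
      margSY (joint W q) = fun a => π a.1 * margSnd q a.2 := by
    intro q hq hqP
    funext a
    simp only [margSY, joint, margSnd, Finset.mul_sum]
    refine Finset.sum_congr rfl fun x _ => ?_
    have h3 := congrFun heq (a.1, x)
    by_cases h0 : margFst P x = 0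
    · rw [← hqP] at h0
      have := (Finset.sum_eq_zero_iff_of_nonneg fun y _ => hq (x, y)).1 h0 a.2 (Finset.mem_univ _)
      simp [this]
    · rw [mul_right_cancel₀ h0 h3]
  refine ⟨joint_mem hp hW, ?_, ?_⟩
  · rw [margSX_joint, margSX_joint, h1]
  · rw [key p hp.1 h1, key P hP.1 rfl, h2]

end Markov

/-! ### Perturbing the channel by uniform noise -/

section Perturbation

variable {A S X Y : Type*} [Fintype A] [Fintype S] [Fintype X] [Fintype Y]

/-- The channel `W` mixed with uniform noise. -/
def mixChannel (W : X → S → ℝ) (t : ℝ) (x : X) (s : S) : ℝ :=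
  (1 - t) * W x s + t * (1 / Fintype.card S)

theorem mixChannel_zero (W : X → S → ℝ) : mixChannel W 0 = W := by
  funext x s
  simp [mixChannel]

theorem sum_uniform_of_channel {W : X → S → ℝ} (hW : ∀ x, W x ∈ stdSimplex ℝ S) (x : X) :
    ∑ _s : S, (1 / (Fintype.card S : ℝ)) = 1 := by
  have : Nonempty S := by
    by_contra hne
    rw [not_nonempty_iff] at hne
    simpa using (hW x).2
  simp

theorem mixChannel_pos {W : X → S → ℝ} (hW : ∀ x, W x ∈ stdSimplex ℝ S) {t : ℝ} (h0 : 0 < t)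
    (h1 : t < 1) (x : X) (s : S) : 0 < mixChannel W t x s := by
  have : Nonempty S := ⟨s⟩
  have hc : (0 : ℝ) < Fintype.card S := by exact_mod_cast Fintype.card_pos
  exact add_pos_of_nonneg_of_pos (mul_nonneg (by linarith) ((hW x).1 s)) (by positivity)

theorem sum_mixChannel {W : X → S → ℝ} (hW : ∀ x, W x ∈ stdSimplex ℝ S) (t : ℝ) (x : X) :
    ∑ s, mixChannel W t x s = 1 := by
  simp only [mixChannel, Finset.sum_add_distrib, ← Finset.mul_sum, (hW x).2,
    sum_uniform_of_channel hW x]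
  ring

theorem continuous_joint_mixChannel (W : X → S → ℝ) (P : X × Y → ℝ) :
    Continuous fun t => joint (mixChannel W t) P := by
  refine continuous_pi fun a => ?_
  simp only [joint, mixChannel]
  fun_prop

/-- The log-sum inequality letter by letter; the common part `t * u` contributes `log 1 = 0`. -/
theorem sum_mix_mul_logb_le {p m u : A → ℝ} (hp : ∀ a, 0 ≤ p a) (hm : ∀ a, 0 ≤ m a)
    (hu : ∀ a, 0 ≤ u a) (h : ∀ a, m a = 0 → p a = 0) {t : ℝ} (h0 : 0 ≤ t) (h1 : t < 1) :
    ∑ a, ((1 - t) * p a + t * u a) *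
        Real.logb 2 (((1 - t) * p a + t * u a) / ((1 - t) * m a + t * u a)) ≤
      (1 - t) * ∑ a, p a * Real.logb 2 (p a / m a) := by
  have ht : 0 < 1 - t := by linarith
  rw [Finset.mul_sum]
  refine Finset.sum_le_sum fun a _ => ?_
  refine (log_sum_two (mul_nonneg ht.le (hp a)) (mul_nonneg h0 (hu a))
    (mul_nonneg ht.le (hm a)) (mul_nonneg h0 (hu a)) (fun h2 => ?_) id).trans_eq ?_
  · rw [h a ((mul_eq_zero.1 h2).resolve_left ht.ne'), mul_zero]
  · rw [mul_div_mul_left _ _ ht.ne', mul_assoc]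
    by_cases h3 : t * u a = 0
    · simp [h3]
    · simp [div_self h3]

/-- The `(S, X)`-law and the product of its margins are perturbed by the same noise law `u`, since
the `X`-marginal does not change. The factor `1 - t` is what makes the rate inequality strict. -/
theorem mutualInfo_mixChannel_le {W : X → S → ℝ} (hW : ∀ x, W x ∈ stdSimplex ℝ S)
    {P : X × Y → ℝ} (hP : P ∈ stdSimplex ℝ (X × Y)) {t : ℝ} (h0 : 0 < t) (h1 : t < 1) :
    mutualInfo (margSX (joint (mixChannel W t) P)) ≤
      (1 - t) * mutualInfo (margSX (joint W P)) := by
  have hWt : ∀ x, mixChannel W t x ∈ stdSimplex ℝ S := fun x =>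
    ⟨fun s => (mixChannel_pos hW h0 h1 x s).le, sum_mixChannel hW t x⟩
  have hp := margSX_mem (joint_mem hP hW)
  have hpt := margSX_mem (joint_mem hP hWt)
  have hm : ∀ {W' : X → S → ℝ}, (∀ x, W' x ∈ stdSimplex ℝ S) →
      margSnd (margSX (joint W' P)) = margFst P := by
    intro W' hW'
    rw [margSX_joint]
    funext x
    simp only [margSnd, ← Finset.sum_mul, (hW' x).2, one_mul]
  have hPX := margFst_mem hP
  set u : S × X → ℝ := fun a => 1 / Fintype.card S * margFst P a.2 with hu
  have e1 : ∀ a, margSX (joint (mixChannel W t) P) a =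
      (1 - t) * margSX (joint W P) a + t * u a := by
    intro a
    rw [margSX_joint, margSX_joint]
    simp only [mixChannel, hu]
    ring
  have e2 : ∀ s, margFst (margSX (joint (mixChannel W t) P)) s =
      (1 - t) * margFst (margSX (joint W P)) s + t * (1 / Fintype.card S) := by
    intro s
    simp only [margFst, e1, Finset.sum_add_distrib, ← Finset.mul_sum, hu]
    have := hPX.2
    simp only [margFst] at this
    rw [this, mul_one]
  rw [mutualInfo_eq hpt.1, mutualInfo_eq hp.1]
  refine le_trans (le_of_eq ?_) (sum_mix_mul_logb_le hp.1 (prod_margins_mem hp).1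
    (u := u) (fun a => mul_nonneg (by positivity) (hPX.1 _))
    (fun a => eq_zero_of_prod_margins hp.1) h0.le h1)
  refine Finset.sum_congr rfl fun a _ => ?_
  rw [e1, e2, hm hWt, hm hW]
  congr 3
  simp only [hu]
  ring

/-- Here too the joint law and its Markov version acquire the same noise term, because the `(X,
Y)`-marginal is fixed and `markovOf` is linear in the `(S, Y)`-marginal. -/
theorem condMutualInfo_mixChannel_le {W : X → S → ℝ} (hW : ∀ x, W x ∈ stdSimplex ℝ S)
    {P : X × Y → ℝ} (hP : P ∈ stdSimplex ℝ (X × Y)) {t : ℝ} (h0 : 0 < t) (h1 : t < 1) :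
    condMutualInfo (joint (mixChannel W t) P) ≤ (1 - t) * condMutualInfo (joint W P) := by
  have hWt : ∀ x, mixChannel W t x ∈ stdSimplex ℝ S := fun x =>
    ⟨fun s => (mixChannel_pos hW h0 h1 x s).le, sum_mixChannel hW t x⟩
  have hp := joint_mem hP hW
  have hpt := joint_mem hP hWt
  set u : S × X × Y → ℝ := fun a => 1 / Fintype.card S * P a.2 with hu
  have e1 : ∀ a, joint (mixChannel W t) P a = (1 - t) * joint W P a + t * u a := by
    intro a
    simp only [joint, mixChannel, hu]
    ring
  have hmY : ∀ {W' : X → S → ℝ}, (∀ x, W' x ∈ stdSimplex ℝ S) →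
      margY (joint W' P) = margSnd P := by
    intro W' hW'
    rw [margY, margXY_joint P fun x => (hW' x).2]
  have e2 : ∀ a, margSY (joint (mixChannel W t) P) a =
      (1 - t) * margSY (joint W P) a + t * (1 / Fintype.card S * margSnd P a.2) := by
    intro a
    simp only [margSY, e1, Finset.sum_add_distrib, ← Finset.mul_sum, hu, margSnd]
  rw [condMutualInfo_eq hpt.1, condMutualInfo_eq hp.1]
  refine le_trans (le_of_eq ?_) (sum_mix_mul_logb_le hp.1 (markovOf_nonneg hp.1)
    (u := u) (fun a => mul_nonneg (by positivity) (hP.1 _))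
    (fun a => eq_zero_of_markovOf hp.1) h0.le h1)
  refine Finset.sum_congr rfl fun a _ => ?_
  have e3 : markovOf (joint (mixChannel W t) P) a =
      (1 - t) * markovOf (joint W P) a + t * u a := by
    simp only [markovOf]
    rw [hmY hWt, hmY hW, margXY_joint P fun x => (hWt x).2, margXY_joint P fun x => (hW x).2, e2]
    by_cases hy : margSnd P a.2.2 = 0
    · have : P a.2 = 0 := (Finset.sum_eq_zero_iff_of_nonneg fun x _ => hP.1 (x, a.2.2)).1 hy
        a.2.1 (Finset.mem_univ _)
      simp [hy, hu, this]
    · simp only [hu]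
      field_simp
  rw [e1, e3]

open Topology in
/-- The exponents are lower semicontinuous at `t = 0` in the noise level `t`. -/
theorem eventually_mixChannel_lt {W : X → S → ℝ} (hW : ∀ x, W x ∈ stdSimplex ℝ S)
    {Q : X × Y → ℝ} (hQ : Q ∈ stdSimplex ℝ (X × Y)) {d : ℝ}
    {K : ℝ → (S × X × Y → ℝ) → Prop} (hK : IsClosed {z : ℝ × (S × X × Y → ℝ) | K z.1 z.2})
    (h : ∀ p ∈ stdSimplex ℝ (S × X × Y), K 0 p → (d : EReal) < klDivergence p (joint W Q)) :
    ∀ᶠ t in 𝓝[>] (0 : ℝ), ∀ p ∈ stdSimplex ℝ (S × X × Y), K t p →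
      (d : EReal) < klDivergence p (joint (mixChannel W t) Q) := by
  have h1 := eventually_forall_lt_klDivergence (t₀ := (0 : ℝ))
    (r := fun t => joint (mixChannel W t) Q) (d := fun _ => d) (K := K)
    (continuous_joint_mixChannel W Q).continuousAt
    (by rw [mixChannel_zero]; exact (joint_mem hQ hW).1) continuousAt_const
    (fun p hp => hK.isOpen_compl.mem_nhds hp) (by rwa [mixChannel_zero])
  filter_upwards [h1.filter_mono nhdsWithin_le_nhds, self_mem_nhdsWithin,
    nhdsWithin_le_nhds (gt_mem_nhds one_pos)] with t ht ht0 ht1 p hp hKp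
  exact ht p hp (joint_nonneg hQ.1 fun x s => (mixChannel_pos hW ht0 ht1 x s).le) hKp

end Perturbation

/-! ### The two bounds -/

section Main

open Topology

variable {S X Y : Type*} [Fintype S] [Fintype X] [Fintype Y]

theorem isClosed_matchingSet_mixChannel (W : X → S → ℝ) (P : X × Y → ℝ) :
    IsClosed {z : ℝ × (S × X × Y → ℝ) | margSX z.2 = margSX (joint (mixChannel W z.1) P) ∧
      margSY z.2 = margSY (joint (mixChannel W z.1) P)} := by
  have h := (continuous_joint_mixChannel W P).comp (continuous_fst (X := ℝ) (Y := S × X × Y → ℝ))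
  exact (isClosed_eq (continuous_margSX.comp continuous_snd) (continuous_margSX.comp h)).inter
    (isClosed_eq (continuous_margSY.comp continuous_snd) (continuous_margSY.comp h))

theorem isClosed_binningSet_mixChannel (W : X → S → ℝ) (P : X × Y → ℝ) :
    IsClosed {z : ℝ × (S × X × Y → ℝ) | margSX z.2 = margSX (joint (mixChannel W z.1) P) ∧
      margY z.2 = margY (joint (mixChannel W z.1) P) ∧
      condEntropy (margSY (joint (mixChannel W z.1) P)) ≤ condEntropy (margSY z.2)} := by
  have h := (continuous_joint_mixChannel W P).comp (continuous_fst (X := ℝ) (Y := S × X × Y → ℝ))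
  exact (isClosed_eq (continuous_margSX.comp continuous_snd) (continuous_margSX.comp h)).inter
    ((isClosed_eq (continuous_margY.comp continuous_snd) (continuous_margY.comp h)).inter
      (isClosed_le (continuous_condEntropy.comp (continuous_margSY.comp h))
        (continuous_condEntropy.comp (continuous_margSY.comp continuous_snd))))

variable {P Q : X × Y → ℝ} {R : ℝ} {W : X → S → ℝ}

theorem le_exponentRate_of_mutualInfo_le (hP : P ∈ stdSimplex ℝ (X × Y))
    (hQ : Q ∈ stdSimplex ℝ (X × Y)) (hW : ∀ x, W x ∈ stdSimplex ℝ S)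
    (hR : mutualInfo (margSX (joint W P)) ≤ R) :
    (⨅ p ∈ matchingSet (joint W P), klDivergence p (joint W Q)) ≤ exponentRate P Q R := by
  refine le_exponentRate hQ fun θ hθ ε hε => ?_
  obtain ⟨d, hθd, hd⟩ := EReal.lt_iff_exists_real_btwn.1 hθ
  rw [EReal.coe_lt_coe_iff] at hθd
  have hd' : ∀ p ∈ matchingSet (joint W P), (d : EReal) < klDivergence p (joint W Q) :=
    fun p hp => hd.trans_le (iInf₂_le p hp)
  have hI0 := mutualInfo_nonneg (margSX_mem (joint_mem hP hW))
  -- At `R = 0` no noise level gives strict inequality, but then `I(S;X) = 0` and the one-bit test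
  -- is enough. For `R > 0`, `(1 - t) * I < R`.
  rcases (hI0.trans hR).eq_or_lt with hR0 | hR0
  · refine eventually_exists_one_bit_scheme hP hQ hR0.le hθd (fun p hp h1 h2 => ?_) hε
    exact (hd' _ (joint_mem_matchingSet hW hP hp h1 h2 (hR0 ▸ hR))).trans_le
      (klDivergence_joint_le (fun x => (hW x).2) p Q)
  · have ev := eventually_mixChannel_lt hW hQ (d := d) (K := fun t p => margSX p = margSX (joint (mixChannel W t) P) ∧
        margSY p = margSY (joint (mixChannel W t) P)) (isClosed_matchingSet_mixChannel W P)
      fun p hp hK => hd' p ⟨hp, by simpa only [mixChannel_zero] using hK⟩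
    obtain ⟨t, ht, ht0, ht1⟩ := (ev.and (Ioo_mem_nhdsGT one_pos)).exists
    refine eventually_exists_scheme (mixChannel_pos hW ht0 ht1) (sum_mixChannel hW t) hP hQ
      (fun p hp => ht p hp.1 hp.2) hθd (Or.inl ?_) hε
    refine (mutualInfo_mixChannel_le hW hP ht0 ht1).trans_lt ?_
    nlinarith

theorem le_exponentRate_of_condMutualInfo_le (hP : P ∈ stdSimplex ℝ (X × Y))
    (hQ : Q ∈ stdSimplex ℝ (X × Y)) (hW : ∀ x, W x ∈ stdSimplex ℝ S)
    (hR : condMutualInfo (joint W P) ≤ R) :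
    min (⨅ p ∈ matchingSet (joint W P), klDivergence p (joint W Q))
        ((⨅ p ∈ binningSet (joint W P), klDivergence p (joint W Q)) +
          ((R - condMutualInfo (joint W P) : ℝ) : EReal)) ≤ exponentRate P Q R := by
  refine le_exponentRate hQ fun θ hθ ε hε => ?_
  set I := condMutualInfo (joint W P) with hI
  obtain ⟨hθ1, hθ2⟩ := lt_min_iff.1 hθ
  have hθ3 : ((θ - (R - I) : ℝ) : EReal) <
      ⨅ p ∈ binningSet (joint W P), klDivergence p (joint W Q) := by
    by_contra hcon
    have h := add_le_add_left (not_lt.1 hcon) ((R - I : ℝ) : EReal)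
    rw [← EReal.coe_add, sub_add_cancel] at h
    exact absurd hθ2 (not_lt.2 h)
  obtain ⟨d₁, hθd₁, hd₁⟩ := EReal.lt_iff_exists_real_btwn.1 hθ1
  obtain ⟨d₂, hθd₂, hd₂⟩ := EReal.lt_iff_exists_real_btwn.1 hθ3
  rw [EReal.coe_lt_coe_iff] at hθd₁ hθd₂
  have hd₁' : ∀ p ∈ matchingSet (joint W P), (d₁ : EReal) < klDivergence p (joint W Q) :=
    fun p hp => hd₁.trans_le (iInf₂_le p hp)
  have hd₂' : ∀ p ∈ binningSet (joint W P), (d₂ : EReal) < klDivergence p (joint W Q) :=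
    fun p hp => hd₂.trans_le (iInf₂_le p hp)
  have hI0 : 0 ≤ I := condMutualInfo_nonneg (joint_mem hP hW).1
  rcases (hI0.trans hR).eq_or_lt with hR0 | hR0
  · have hIz : I = 0 := le_antisymm (hR0 ▸ hR) hI0
    refine eventually_exists_one_bit_scheme hP hQ hR0.le (d := d₂) (by linarith)
      (fun p hp h1 h2 => ?_) hε
    exact (hd₂' _ (joint_mem_binningSet hW hp h1 h2 hIz.le)).trans_le
      (klDivergence_joint_le (fun x => (hW x).2) p Q)
  · have ev₁ := eventually_mixChannel_lt hW hQ (d := d₁) (K := fun t p => margSX p = margSX (joint (mixChannel W t) P) ∧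
        margSY p = margSY (joint (mixChannel W t) P)) (isClosed_matchingSet_mixChannel W P)
      fun p hp hK => hd₁' p ⟨hp, by simpa only [mixChannel_zero] using hK⟩
    have ev₂ := eventually_mixChannel_lt hW hQ (d := d₂) (K := fun t p => margSX p = margSX (joint (mixChannel W t) P) ∧
        margY p = margY (joint (mixChannel W t) P) ∧
        condEntropy (margSY (joint (mixChannel W t) P)) ≤ condEntropy (margSY p))
      (isClosed_binningSet_mixChannel W P)
      fun p hp hK => hd₂' p ⟨hp, by simpa only [mixChannel_zero] using hK⟩
    obtain ⟨t, ⟨ht₁, ht₂⟩, ht0, ht1⟩ := ((ev₁.and ev₂).and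
      (Ioo_mem_nhdsGT one_pos)).exists
    have hIt := condMutualInfo_mixChannel_le hW hP ht0 ht1
    rw [← hI] at hIt
    refine eventually_exists_scheme (mixChannel_pos hW ht0 ht1) (sum_mixChannel hW t) hP hQ
      (fun p hp => ht₁ p hp.1 hp.2) hθd₁ ?_ hε
    -- If the rate exceeds the perturbed `I(S;X)`, no binning is needed and the first exponent alone
    -- decides. Otherwise binning is used, and the noise only enlarges `R - I(S;X|Y)`.
    rcases lt_or_ge (mutualInfo (margSX (joint (mixChannel W t) P))) R with h | h
    · exact Or.inl h
    · exact Or.inr ⟨by nlinarith, h, d₂, fun p hp => ht₂ p hp.1 hp.2, by nlinarith⟩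

end Main

end BinTest

end

theorem theorem2 {X Y S : Type*} [Fintype X] [Fintype Y] [Fintype S]
    (P Q : X × Y → ℝ) (hP : P ∈ stdSimplex ℝ (X × Y)) (hQ : Q ∈ stdSimplex ℝ (X × Y))
    (R : ℝ) (W : X → S → ℝ) (hW : ∀ x, W x ∈ stdSimplex ℝ S) :
    (condMutualInfo (joint W P) ≤ R →
      min (⨅ p ∈ matchingSet (joint W P), klDivergence p (joint W Q))
          ((⨅ p ∈ binningSet (joint W P), klDivergence p (joint W Q)) +
            ((R - condMutualInfo (joint W P) : ℝ) : EReal))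
        ≤ exponentRate P Q R) ∧
    (mutualInfo (margSX (joint W P)) ≤ R →
      (⨅ p ∈ matchingSet (joint W P), klDivergence p (joint W Q)) ≤ exponentRate P Q R) := by
  exact ⟨le_exponentRate_of_condMutualInfo_le hP hQ hW, le_exponentRate_of_mutualInfo_le hP hQ hW⟩
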